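/- **Setting.** Let $\widehat{\mathcal L}^{\mathrm{full}}(X)=\frac1N\sum_{i=1}^N \ell\big(f(W_0+X;x_i),y_i\big)$, $X\in\mathbb R^{m\times n}$, be the empirical full fine-tuning loss of a network $f$ in one weight matrix with pre-trained value $W_0$, and assume that it is twice differentiable. For $\lambda\ge 0$ put $$\widehat{\mathcal L}^{\mathrm{full}}_\lambda(X)=\widehat{\mathcal L}^{\mathrm{full}}(X)+\lambda\|X\|_*,\qquad \widehat{\mathcal L}^{\mathrm{lora}}_\lambda(A,B)=\widehat{\mathcal L}^{\mathrm{full}}(AB^\intercal)+\tfrac{\lambda}{2}\big(\|A\|_F^2+\|B\|_F^2\big),$$ where $A\in\mathbb R^{m\times r}$, $B\in\mathbb R^{n\times r}$ and $\|\cdot\|_*$ is the nuclear norm. Write $\sigma_1(X)\ge\sigma_2(X)\ge\dots$ for the singular values of $X$. The $(r,D)$-RSC constant of a twice-differentiable $g\colon\mathbb R^{m\times n}\to\mathbb R$ about $X_\star$ is the largest $\alpha$ such that $$\langle\nabla g(X)-\nabla g(X_\star),X-X_\star\rangle\ge\alpha\|X-X_\star\|_F^2$$ for all $X$ with $\|X-X_\star\|_F\le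 D$ and $\operatorname{rank}X\le r$. The $(r,D)$-RSM constant is the smallest $\beta$ such that $$\nabla^2g(X)[UX+XV,UX+XV]\le\beta\|UX+XV\|_F^2$$ for all such $X$ and all $U\in\mathbb R^{m\times m}$, $V\in\mathbb R^{n\times n}$ with $\operatorname{rank}U=\operatorname{rank}V=1$ and $\|U\|_F=\|V\|_F=1$. (These are the supremum, respectively the infimum, of the admissible real numbers, in $[-\infty,\infty]$.) A second-order stationary point (SOSP) is a point where the gradient vanishes and the Hessian is positive semidefinite. **Theorem.** Let $\lambda\ge0$, and assume that $\widehat{\mathcal L}^{\mathrm{full}}_\lambda$ has a global minimizer $X_\star$ of rank $r_\star$. Let $\alpha$ and $\beta$ be the $(r,D)$-RSC and $(r,D)$-RSM constants of $\widehat{\mathcal L}^{\mathrm{full}}$ about $X_\star$, and assume $\alpha>0$, $\beta<\infty$ and $r\ge r_\star$. Then every SOSP $(A,B)$ of $\widehat{\mathcal L}^{\mathrm{lora}}_\lambda$ such that $X=AB^\intercal$ satisfies $\|X-X_\star\|_F\le D$ has the following properties. 1. If $2\alpha>\beta$, then $X$ is a global minimum of $\widehat{\mathcal L}^{\mathrm{full}}_\lambda$.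 2. If $2\alpha\le\beta$, then one of the following holds: (i) $X$ is a global minimum of $\widehat{\mathcal L}^{\mathrm{full}}_\lambda$; (ii) $X$ is not a global minimum of $\widehat{\mathcal L}^{\mathrm{full}}_\lambda$, $r_\star\ge1$, $\operatorname{rank}(X)=r$, $\sigma_r(X)\ge\frac{2\alpha}{\beta}\sigma_{r_\star}(X)$, and for every projection $\Pi_{\mathrm{rank}\le r_\star}(X)$ of $X$ onto the matrices of rank at most $r_\star$ (a nearest point in Frobenius norm) $$\|X-X_\star\|_F^2\ \ge\ \frac{\|X-\Pi_{\mathrm{rank}\le r_\star}(X)\|_F^2}{1-\frac{2\alpha\,\sigma_{r_\star}(X)}{\beta\,\sigma_r(X)}}.$$ If the denominator is $0$, that is, if $\sigma_r(X)=\frac{2\alpha}{\beta}\sigma_{r_\star}(X)$, then the numerator is $0$ as well, and the right-hand side is read as $0$. -/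

import Mathlib

/- Matrices carry the Frobenius norm `‖·‖` throughout. -/
attribute [local instance] Matrix.frobeniusNormedAddCommGroup Matrix.frobeniusNormedSpace

namespace LoRA

/-- The matrix inner product `⟨A, B⟩ = tr(Aᵀ B)`. -/
noncomputable def frobInner {m n : ℕ} (A B : Matrix (Fin m) (Fin n) ℝ) : ℝ :=
  (A.transpose * B).trace

/-- The `k`-th largest singular value `σ_k(X)`, counted from `k = 1`.
Mathlib's sequence starts at index `0`. The value at `k = 0` has no meaning. -/
noncomputable def singVal {m n : ℕ} (X : Matrix (Fin m) (Fin n) ℝ) (k : ℕ) : ℝ :=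
  (Matrix.toEuclideanLin X).singularValues (k - 1)

/-- The nuclear norm `‖X‖_*`, the sum of the singular values. -/
noncomputable def nuclearNorm {m n : ℕ} (X : Matrix (Fin m) (Fin n) ℝ) : ℝ :=
  ∑ k ∈ Finset.Icc 1 (min m n), singVal X k

/-- `P` is a projection (a nearest point in Frobenius norm) of `X` onto the set of matrices of
rank at most `k`. -/
def IsRankProj {m n : ℕ} (k : ℕ) (X P : Matrix (Fin m) (Fin n) ℝ) : Prop :=
  P.rank ≤ k ∧ ∀ Y : Matrix (Fin m) (Fin n) ℝ, Y.rank ≤ k → ‖X - P‖ ≤ ‖X - Y‖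

/-- A projection onto the matrices of rank at most `k` exists. -/
theorem exists_isRankProj {m n : ℕ} (k : ℕ) (X : Matrix (Fin m) (Fin n) ℝ) :
    ∃ P, IsRankProj k X P := by
  let φ : Matrix (Fin m) (Fin n) ℝ →ₗ[ℝ] ((Fin n → ℝ) →L[ℝ] (Fin m → ℝ)) :=
    LinearMap.toContinuousLinearMap.toLinearMap ∘ₗ Matrix.toLin'.toLinearMap
  have hφ : Continuous φ := φ.continuous_of_finiteDimensional
  have hopen : IsOpen {Y : Matrix (Fin m) (Fin n) ℝ | k + 1 ≤ Y.rank} := by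
    convert (isOpen_setOfPred_nat_le_rank (𝕜 := ℝ) (E := Fin n → ℝ)
      (F := Fin m → ℝ) (k + 1)).preimage hφ using 1
    ext Y
    have : ((φ Y : (Fin n → ℝ) →L[ℝ] (Fin m → ℝ)) : (Fin n → ℝ) →ₗ[ℝ] (Fin m → ℝ)).rank
        = (Y.rank : Cardinal) := by
      rw [Matrix.rank, Module.finrank_eq_rank]
      rfl
    simp only [Set.mem_ofPred_eq, Set.mem_preimage, this]
    norm_cast
  have hcl : IsClosed {Y : Matrix (Fin m) (Fin n) ℝ | Y.rank ≤ k} := by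
    rw [← isOpen_compl_iff]
    convert hopen using 1
    ext Y
    simp only [Set.mem_compl_iff, Set.mem_ofPred_eq, not_le, Nat.lt_iff_add_one_le]
  have hne : {Y : Matrix (Fin m) (Fin n) ℝ | Y.rank ≤ k}.Nonempty := ⟨0, by simp⟩
  have : ProperSpace (Matrix (Fin m) (Fin n) ℝ) := FiniteDimensional.proper_real _
  obtain ⟨P, hP, hd⟩ := hcl.exists_infDist_eq_dist hne X
  refine ⟨P, hP, fun Y hY => ?_⟩
  rw [← dist_eq_norm, ← dist_eq_norm, ← hd]
  exact Metric.infDist_le_dist_of_mem hY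

/-- The gradient matrix of `f` at `X`: the matrix of partial derivatives. -/
noncomputable def grad {m n : ℕ} (f : Matrix (Fin m) (Fin n) ℝ → ℝ)
    (X : Matrix (Fin m) (Fin n) ℝ) : Matrix (Fin m) (Fin n) ℝ :=
  Matrix.of fun i j => fderiv ℝ f X (Matrix.single i j 1)

/-- The Hessian quadratic form `∇²f(x)[u, u]`. -/
noncomputable def hessQuad {E : Type*} [NormedAddCommGroup E] [NormedSpace ℝ E]
    (f : E → ℝ) (x u : E) : ℝ :=
  fderiv ℝ (fderiv ℝ f) x u u

/-- `f` is twice differentiable everywhere. -/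
def TwiceDifferentiable {E : Type*} [NormedAddCommGroup E] [NormedSpace ℝ E]
    (f : E → ℝ) : Prop :=
  Differentiable ℝ f ∧ Differentiable ℝ (fderiv ℝ f)

/-- Second-order stationary point: the derivative vanishes and the Hessian is positive
semidefinite. -/
def IsSOSP {E : Type*} [NormedAddCommGroup E] [NormedSpace ℝ E] (f : E → ℝ) (x : E) : Prop :=
  fderiv ℝ f x = 0 ∧ ∀ u : E, 0 ≤ hessQuad f x u

/-- `x` is a global minimum of `f`. -/
def IsGlobalMin {E : Type*} (f : E → ℝ) (x : E) : Prop :=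
  ∀ y : E, f x ≤ f y

/-- `f` is `(a, r, D)`-restricted strongly convex about `Xs`. -/
def RestrictedStronglyConvex {m n : ℕ} (f : Matrix (Fin m) (Fin n) ℝ → ℝ)
    (Xs : Matrix (Fin m) (Fin n) ℝ) (r : ℕ) (D a : ℝ) : Prop :=
  ∀ X : Matrix (Fin m) (Fin n) ℝ, ‖X - Xs‖ ≤ D → X.rank ≤ r →
    a * ‖X - Xs‖ ^ 2 ≤ frobInner (grad f X - grad f Xs) (X - Xs)

/-- `f` is `(b, r, D)`-restricted smooth about `Xs`. -/
def RestrictedSmooth {m n : ℕ} (f : Matrix (Fin m) (Fin n) ℝ → ℝ)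
    (Xs : Matrix (Fin m) (Fin n) ℝ) (r : ℕ) (D b : ℝ) : Prop :=
  ∀ X : Matrix (Fin m) (Fin n) ℝ, ‖X - Xs‖ ≤ D → X.rank ≤ r →
    ∀ U : Matrix (Fin m) (Fin m) ℝ, U.rank = 1 → ‖U‖ = 1 →
    ∀ V : Matrix (Fin n) (Fin n) ℝ, V.rank = 1 → ‖V‖ = 1 →
      hessQuad f X (U * X + X * V) ≤ b * ‖U * X + X * V‖ ^ 2

/-- The `(r, D)`-RSC constant of `f` about `Xs`: the largest admissible constant. It is `⊥` if
there is none, and `⊤` if every real number is admissible. -/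
noncomputable def rscConst {m n : ℕ} (f : Matrix (Fin m) (Fin n) ℝ → ℝ)
    (Xs : Matrix (Fin m) (Fin n) ℝ) (r : ℕ) (D : ℝ) : EReal :=
  sSup ((fun a : ℝ => (a : EReal)) '' {a : ℝ | RestrictedStronglyConvex f Xs r D a})

/-- The `(r, D)`-RSM constant of `f` about `Xs`: the smallest admissible constant. It is `⊤` if
there is none, and `⊥` if every real number is admissible. -/
noncomputable def rsmConst {m n : ℕ} (f : Matrix (Fin m) (Fin n) ℝ → ℝ)
    (Xs : Matrix (Fin m) (Fin n) ℝ) (r : ℕ) (D : ℝ) : EReal :=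
  sInf ((fun b : ℝ => (b : EReal)) '' {b : ℝ | RestrictedSmooth f Xs r D b})

/-- The empirical full fine-tuning loss `X ↦ (1/N) ∑ᵢ ℓ(net(W₀ + X; xᵢ), yᵢ)`. Here `net` is the
network as a function of the fine-tuned weight matrix (all other parameters are frozen) and of
the input, `ℓ` is the loss function, and `(xᵢ, yᵢ)` is the data set. -/
noncomputable def fullLoss {m n K N : ℕ} {𝒳 𝒴 : Type*}
    (ℓ : (Fin K → ℝ) → 𝒴 → ℝ) (net : Matrix (Fin m) (Fin n) ℝ → 𝒳 → Fin K → ℝ)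
    (W₀ : Matrix (Fin m) (Fin n) ℝ) (x : Fin N → 𝒳) (y : Fin N → 𝒴)
    (X : Matrix (Fin m) (Fin n) ℝ) : ℝ :=
  (1 / (N : ℝ)) * ∑ i, ℓ (net (W₀ + X) (x i)) (y i)

/-- The nuclear-norm regularized full fine-tuning loss `L(X) + lam ‖X‖_*`. -/
noncomputable def regFull {m n : ℕ} (lam : ℝ) (L : Matrix (Fin m) (Fin n) ℝ → ℝ)
    (X : Matrix (Fin m) (Fin n) ℝ) : ℝ :=
  L X + lam * nuclearNorm X

/-- The weight-decayed rank-`r` LoRA loss `L(A Bᵀ) + (lam/2)(‖A‖_F² + ‖B‖_F²)`. -/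
noncomputable def regLora {m n : ℕ} (r : ℕ) (lam : ℝ) (L : Matrix (Fin m) (Fin n) ℝ → ℝ)
    (p : Matrix (Fin m) (Fin r) ℝ × Matrix (Fin n) (Fin r) ℝ) : ℝ :=
  L (p.1 * p.2.transpose) + lam / 2 * (‖p.1‖ ^ 2 + ‖p.2‖ ^ 2)

end LoRA

/-! Put `T = -∇L(X)` and suppose `X ≠ Xs`. Stationarity says `T B = lam A` and `Tᵀ A = lam B`.
Pairing `T` with `X` then gives `⟨T, X⟩ = lam (‖A‖² + ‖B‖²) / 2 ≥ lam ‖X‖_*`, and with first-order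
optimality of `Xs` this becomes `⟨∇L(X) - ∇L(Xs), X - Xs⟩ ≤ ⟨T, Xs⟩ - lam ‖Xs‖_*`
(`frobInner_grad_sub_le`). By RSC the left side is at least `α ‖X - Xs‖² > 0`, so by duality the
operator norm `γ` of `T` exceeds `lam`.

Let `(z, w)` be a leading singular pair of `T`. The Hessian is tested on directions `(z pᵀ, w qᵀ)`.
A kernel vector of `A` or `B` would give negative curvature, so `X` has rank `r`
(`injective_of_isSOSP`). With `(u, v)` the `r`-th singular pair of `X`, the choice `p = Aᵀ u`, `q =
Bᵀ v` moves `X` along `z uᵀ X + X v wᵀ`, a direction covered by RSM, and yields `γ - lam ≤ β σ_r`.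

On the singular spaces of `X`, `T` is `lam` times the polar factor `K`, so `T = lam K + γ W` with
`W` living on the complements and `K + W` a contraction. Duality gives `⟨T, Xs⟩ ≤ lam ‖Xs‖_* + (γ -
lam) ⟨W, Xs⟩`, hence `α ‖X - Xs‖² ≤ β σ_r ⟨W, Xs⟩`. A sharpened Eckart–Young bound,
`IsSVD.two_mul_frobInner_le`, controls `2 σ_rs ⟨W, Xs⟩` by `‖X - Xs‖²` minus the squared tail of
singular values. Together: `β σ_r ‖X - Y‖² ≤ (β σ_r - 2 α σ_rs) ‖X - Xs‖²` for the truncation `Y` of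
`X` to rank `rs`. All claims follow, since `σ_r ≤ σ_rs`. -/

namespace LoRA

open Matrix

/-! ### Singular value decomposition and nuclear/operator norm duality. -/

section SingularValues

variable {m n k : ℕ}

theorem frobInner_eq_sum_col (A B : Matrix (Fin m) (Fin n) ℝ) :
    frobInner A B = ∑ j, Aᵀ j ⬝ᵥ Bᵀ j := rfl

theorem frobInner_eq_sum_row (A B : Matrix (Fin m) (Fin n) ℝ) :
    frobInner A B = ∑ i, A i ⬝ᵥ B i := by
  rw [frobInner_eq_sum_col]
  simp only [dotProduct, transpose_apply]
  exact Finset.sum_comm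

theorem frobInner_comm (A B : Matrix (Fin m) (Fin n) ℝ) : frobInner A B = frobInner B A := by
  simp only [frobInner_eq_sum_col, dotProduct_comm]

theorem frobInner_add_left (A B C : Matrix (Fin m) (Fin n) ℝ) :
    frobInner (A + B) C = frobInner A C + frobInner B C := by
  simp [frobInner, Matrix.add_mul]

theorem frobInner_add_right (A B C : Matrix (Fin m) (Fin n) ℝ) :
    frobInner A (B + C) = frobInner A B + frobInner A C := by
  simp [frobInner, Matrix.mul_add]

theorem frobInner_sub_left (A B C : Matrix (Fin m) (Fin n) ℝ) :
    frobInner (A - B) C = frobInner A C - frobInner B C := by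
  simp [frobInner, Matrix.sub_mul]

theorem frobInner_sub_right (A B C : Matrix (Fin m) (Fin n) ℝ) :
    frobInner A (B - C) = frobInner A B - frobInner A C := by
  simp [frobInner, Matrix.mul_sub]

theorem frobInner_smul_left (c : ℝ) (A B : Matrix (Fin m) (Fin n) ℝ) :
    frobInner (c • A) B = c * frobInner A B := by
  simp [frobInner]

theorem frobInner_smul_right (c : ℝ) (A B : Matrix (Fin m) (Fin n) ℝ) :
    frobInner A (c • B) = c * frobInner A B := by
  simp [frobInner]

theorem frobInner_neg_left (A B : Matrix (Fin m) (Fin n) ℝ) :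
    frobInner (-A) B = -frobInner A B := by
  simp [frobInner]

theorem norm_sq_eq_frobInner (A : Matrix (Fin m) (Fin n) ℝ) : ‖A‖ ^ 2 = frobInner A A := by
  rw [frobenius_norm_def, ← Real.sqrt_eq_rpow, Real.sq_sqrt (by positivity), frobInner_eq_sum_row]
  simp [dotProduct, sq]

theorem norm_sub_sq_eq_frobInner (A B : Matrix (Fin m) (Fin n) ℝ) :
    ‖A - B‖ ^ 2 = ‖A‖ ^ 2 - 2 * frobInner A B + ‖B‖ ^ 2 := by
  simp only [norm_sq_eq_frobInner, frobInner_sub_left, frobInner_sub_right, frobInner_comm B A]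
  ring

theorem frobInner_vecMulVec (A : Matrix (Fin m) (Fin n) ℝ) (x : Fin m → ℝ) (y : Fin n → ℝ) :
    frobInner A (vecMulVec x y) = x ⬝ᵥ A *ᵥ y := by
  simp only [frobInner_eq_sum_row, dotProduct, mulVec, vecMulVec_apply, Finset.mul_sum]
  exact Finset.sum_congr rfl fun i _ => Finset.sum_congr rfl fun j _ => by ring

theorem frobInner_vecMulVec_vecMulVec (x a : Fin m → ℝ) (y b : Fin n → ℝ) :
    frobInner (vecMulVec x y) (vecMulVec a b) = (x ⬝ᵥ a) * (y ⬝ᵥ b) := by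
  rw [frobInner_vecMulVec, vecMulVec_mulVec]
  simp [dotProduct_comm, mul_comm]

theorem norm_vecMulVec_sq (x : Fin m → ℝ) (y : Fin n → ℝ) :
    ‖vecMulVec x y‖ ^ 2 = (x ⬝ᵥ x) * (y ⬝ᵥ y) := by
  rw [norm_sq_eq_frobInner, frobInner_vecMulVec_vecMulVec]

theorem norm_vecMulVec_eq_one {x : Fin m → ℝ} {y : Fin n → ℝ} (hx : x ⬝ᵥ x = 1)
    (hy : y ⬝ᵥ y = 1) : ‖vecMulVec x y‖ = 1 := by
  have := norm_vecMulVec_sq x y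
  rw [hx, hy, mul_one] at this
  exact (pow_eq_one_iff_of_nonneg (norm_nonneg _) two_ne_zero).1 this

theorem rank_vecMulVec_eq_one {x : Fin m → ℝ} {y : Fin n → ℝ} (hx : x ⬝ᵥ x = 1)
    (hy : y ⬝ᵥ y = 1) : (vecMulVec x y).rank = 1 := by
  refine le_antisymm (rank_vecMulVec_le x y) (Nat.one_le_iff_ne_zero.2 fun h => ?_)
  rw [rank, Submodule.finrank_eq_zero, LinearMap.range_eq_bot] at h
  have h0 : vecMulVec x y *ᵥ y = 0 := by rw [← mulVecLin_apply, h, LinearMap.zero_apply]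
  have h1 : x = 0 := by simpa [vecMulVec_mulVec, hy] using h0
  simp [h1] at hx

theorem frobInner_mul_transpose (Z : Matrix (Fin m) (Fin n) ℝ) (A : Matrix (Fin m) (Fin k) ℝ)
    (B : Matrix (Fin n) (Fin k) ℝ) : frobInner Z (A * Bᵀ) = frobInner (Z * B) A := by
  rw [frobInner, frobInner, transpose_mul, ← Matrix.mul_assoc, Matrix.trace_mul_comm,
    ← Matrix.mul_assoc]

theorem frobInner_mul_transpose' (Z : Matrix (Fin m) (Fin n) ℝ) (A : Matrix (Fin m) (Fin k) ℝ)
    (B : Matrix (Fin n) (Fin k) ℝ) : frobInner Z (A * Bᵀ) = frobInner (Zᵀ * A) B := by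
  rw [frobInner_comm (Zᵀ * A), frobInner, frobInner, ← Matrix.mul_assoc, Matrix.trace_mul_comm]

theorem dotProduct_mulVec_transpose (M : Matrix (Fin m) (Fin n) ℝ) (x : Fin m → ℝ)
    (y : Fin n → ℝ) : x ⬝ᵥ M *ᵥ y = Mᵀ *ᵥ x ⬝ᵥ y := by
  rw [dotProduct_mulVec, mulVec_transpose]

theorem dotProduct_le_of_sq_le {x y : Fin m → ℝ} {c : ℝ} (hc : 0 ≤ c) (hx : x ⬝ᵥ x ≤ c ^ 2)
    (hy : y ⬝ᵥ y ≤ 1) : x ⬝ᵥ y ≤ c := by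
  have h : (x ⬝ᵥ y) ^ 2 ≤ (x ⬝ᵥ x) * (y ⬝ᵥ y) := by
    simpa [dotProduct, sq] using Finset.sum_mul_sq_le_sq_mul_sq Finset.univ x y
  refine le_of_sq_le_sq (h.trans ?_) hc
  have := dotProduct_self_star_nonneg x
  simp only [star_trivial] at this
  nlinarith

theorem dotProduct_self_nonneg' (x : Fin m → ℝ) : 0 ≤ x ⬝ᵥ x := by
  simpa using dotProduct_self_star_nonneg x

/-- A singular value decomposition `X vᵢ = σᵢ uᵢ`, `Xᵀ uᵢ = σᵢ vᵢ` with the right singular vectors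
`v` an orthonormal basis and `uᵢ = 0` whenever `σᵢ = 0`. -/
structure IsSVD (X : Matrix (Fin m) (Fin n) ℝ) (σ : Fin n → ℝ) (v : Fin n → Fin n → ℝ)
    (u : Fin n → Fin m → ℝ) : Prop where
  nonneg : ∀ i, 0 ≤ σ i
  orthonormal : ∀ i j, v i ⬝ᵥ v j = if i = j then 1 else 0
  parseval : ∀ x y, x ⬝ᵥ y = ∑ i, (v i ⬝ᵥ x) * (v i ⬝ᵥ y)
  mulVec : ∀ i, X *ᵥ v i = σ i • u i
  transpose_mulVec : ∀ i, Xᵀ *ᵥ u i = σ i • v i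
  orthogonal : ∀ i j, i ≠ j → u i ⬝ᵥ u j = 0
  unit : ∀ i, 0 < σ i → u i ⬝ᵥ u i = 1
  zero : ∀ i, σ i = 0 → u i = 0

theorem exists_isSVD (X : Matrix (Fin m) (Fin n) ℝ) :
    ∃ v u, IsSVD X (fun i : Fin n => (toEuclideanLin X).singularValues i) v u := by
  set T := toEuclideanLin X with hT
  have hn : Module.finrank ℝ (EuclideanSpace ℝ (Fin n)) = n := by simp
  set b := T.isSymmetric_adjoint_comp_self.eigenvectorBasis hn with hb
  set σ : Fin n → ℝ := fun i => T.singularValues i with hσ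
  set v : Fin n → Fin n → ℝ := fun i => (b i).ofLp with hv
  have hadj : LinearMap.adjoint T = toEuclideanLin Xᵀ := by
    rw [← conjTranspose_eq_transpose_of_trivial, toEuclideanLin_conjTranspose_eq_adjoint]
  have heig : ∀ i, Xᵀ *ᵥ (X *ᵥ v i) = σ i ^ 2 • v i := by
    intro i
    have h := T.isSymmetric_adjoint_comp_self.apply_eigenvectorBasis hn i
    rw [← T.sq_singularValues_fin hn i] at h
    rw [← hb, LinearMap.comp_apply, hadj] at h
    have h2 := congrArg WithLp.ofLp h
    simpa [hT, toLpLin_apply] using h2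
  have hinner : ∀ x y : EuclideanSpace ℝ (Fin n), inner ℝ x y = x.ofLp ⬝ᵥ y.ofLp := by
    intro x y
    simp [EuclideanSpace.inner_eq_star_dotProduct, dotProduct_comm]
  have horth : ∀ i j, v i ⬝ᵥ v j = if i = j then 1 else 0 := by
    intro i j
    rw [← hinner]
    exact orthonormal_iff_ite.1 b.orthonormal i j
  have hpars : ∀ x y : Fin n → ℝ, x ⬝ᵥ y = ∑ i, (v i ⬝ᵥ x) * (v i ⬝ᵥ y) := by
    intro x y
    have h := b.sum_inner_mul_inner (WithLp.toLp 2 x) (WithLp.toLp 2 y)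
    simp only [hinner] at h
    rw [← h]
    exact Finset.sum_congr rfl fun i _ => by rw [dotProduct_comm x]
  have hXX : ∀ i j, X *ᵥ v i ⬝ᵥ X *ᵥ v j = if i = j then σ i ^ 2 else 0 := by
    intro i j
    rw [dotProduct_mulVec_transpose, heig, smul_dotProduct, horth]
    split_ifs <;> simp
  have hzero : ∀ i, σ i = 0 → X *ᵥ v i = 0 := by
    intro i hi
    have := hXX i i
    rw [hi] at this
    simpa using this
  -- Since `0⁻¹ = 0`, this formula also gives `uᵢ = 0` when `σᵢ = 0`.
  refine ⟨v, fun i => (σ i)⁻¹ • X *ᵥ v i, fun i => T.singularValues_nonneg i, horth, hpars,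
    ?_, ?_, ?_, ?_, ?_⟩
  · intro i
    by_cases hi : σ i = 0
    · simp [hzero i hi]
    · exact (smul_inv_smul₀ hi _).symm
  · intro i
    rw [mulVec_smul, heig]
    by_cases hi : σ i = 0
    · simp [hi]
    · rw [smul_smul, sq, inv_mul_cancel_left₀ hi]
  · intro i j hij
    simp [hXX, hij]
  · intro i hi
    simp only [smul_dotProduct, dotProduct_smul, hXX, if_true, smul_eq_mul]
    have : σ i ≠ 0 := hi.ne'
    field_simp
  · intro i hi
    simp [hzero i hi]

namespace IsSVD

variable {X : Matrix (Fin m) (Fin n) ℝ} {σ : Fin n → ℝ} {v : Fin n → Fin n → ℝ}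
  {u : Fin n → Fin m → ℝ}

theorem unit_le (h : IsSVD X σ v u) (i : Fin n) : u i ⬝ᵥ u i ≤ 1 := by
  rcases (h.nonneg i).lt_or_eq with hi | hi
  · exact (h.unit i hi).le
  · simp [h.zero i hi.symm]

theorem frobInner_eq_sum (h : IsSVD X σ v u) {l : ℕ} (Y Z : Matrix (Fin l) (Fin n) ℝ) :
    frobInner Y Z = ∑ i, Y *ᵥ v i ⬝ᵥ Z *ᵥ v i := by
  rw [frobInner_eq_sum_row]
  simp only [h.parseval (Y _)]
  rw [Finset.sum_comm]
  refine Finset.sum_congr rfl fun i _ => Finset.sum_congr rfl fun j _ => ?_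
  rw [dotProduct_comm (v i), dotProduct_comm (v i)]
  rfl

theorem eq_sum (h : IsSVD X σ v u) (x : Fin n → ℝ) : x = ∑ i, (v i ⬝ᵥ x) • v i := by
  refine dotProduct_eq _ _ fun y => ?_
  rw [h.parseval x y, sum_dotProduct]
  simp

theorem mulVec_eq_sum (h : IsSVD X σ v u) {l : ℕ} (Y : Matrix (Fin l) (Fin n) ℝ)
    (x : Fin n → ℝ) : Y *ᵥ x = ∑ i, (v i ⬝ᵥ x) • Y *ᵥ v i := by
  conv_lhs => rw [h.eq_sum x]
  rw [Matrix.mulVec_sum]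
  simp [mulVec_smul]

theorem sum_smul_dotProduct_self (h : IsSVD X σ v u) (c : Fin n → ℝ) :
    (∑ i, c i • u i) ⬝ᵥ (∑ i, c i • u i) = ∑ i, c i ^ 2 * (u i ⬝ᵥ u i) := by
  rw [sum_dotProduct]
  refine Finset.sum_congr rfl fun i _ => ?_
  rw [dotProduct_sum, Finset.sum_eq_single i]
  · simp only [smul_dotProduct, dotProduct_smul, smul_eq_mul]
    ring
  · intro j _ hj
    simp [h.orthogonal i j hj.symm]
  · simp

/-- The partial isometry `∑ uᵢ vᵢᵀ`. -/
theorem polar_mulVec (x : Fin n → ℝ) :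
    (∑ i, vecMulVec (u i) (v i)) *ᵥ x = ∑ i, (v i ⬝ᵥ x) • u i := by
  rw [Matrix.sum_mulVec]
  simp [vecMulVec_mulVec]

theorem polar_mulVec_self (h : IsSVD X σ v u) (j : Fin n) :
    (∑ i, vecMulVec (u i) (v i)) *ᵥ v j = u j := by
  rw [polar_mulVec]
  simp [h.orthonormal]

theorem polar_mulVec_sq (h : IsSVD X σ v u) (x : Fin n → ℝ) :
    (∑ i, vecMulVec (u i) (v i)) *ᵥ x ⬝ᵥ (∑ i, vecMulVec (u i) (v i)) *ᵥ x =
      ∑ i, (v i ⬝ᵥ x) ^ 2 * (u i ⬝ᵥ u i) := by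
  rw [polar_mulVec, h.sum_smul_dotProduct_self]

theorem dotProduct_self_eq_sum (h : IsSVD X σ v u) (x : Fin n → ℝ) :
    x ⬝ᵥ x = ∑ i, (v i ⬝ᵥ x) ^ 2 := by
  rw [h.parseval]
  simp [sq]

theorem mulVec_dotProduct_self (h : IsSVD X σ v u) (x : Fin n → ℝ) :
    X *ᵥ x ⬝ᵥ X *ᵥ x = ∑ i, σ i ^ 2 * (v i ⬝ᵥ x) ^ 2 := by
  rw [h.mulVec_eq_sum X]
  simp only [h.mulVec, smul_smul]
  rw [h.sum_smul_dotProduct_self]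
  refine Finset.sum_congr rfl fun i _ => ?_
  rcases (h.nonneg i).lt_or_eq with hi | hi
  · rw [h.unit i hi]
    ring
  · simp [← hi]

/-- Half of the duality of operator and nuclear norm: in the basis `v`, the pairing is `∑ σᵢ ⟨Z vᵢ,
uᵢ⟩`, each factor at most `c`. The polar factor attains equality for `c = 1`. -/
theorem frobInner_le (h : IsSVD X σ v u) {Z : Matrix (Fin m) (Fin n) ℝ} {c : ℝ} (hc : 0 ≤ c)
    (hZ : ∀ x, Z *ᵥ x ⬝ᵥ Z *ᵥ x ≤ c ^ 2 * (x ⬝ᵥ x)) :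
    frobInner Z X ≤ c * ∑ i, σ i := by
  rw [h.frobInner_eq_sum, Finset.mul_sum]
  refine Finset.sum_le_sum fun i _ => ?_
  rw [h.mulVec, dotProduct_smul, smul_eq_mul, mul_comm]
  refine mul_le_mul_of_nonneg_right (dotProduct_le_of_sq_le hc ?_ (h.unit_le i)) (h.nonneg i)
  simpa [h.orthonormal] using hZ (v i)

theorem frobInner_polar (h : IsSVD X σ v u) :
    frobInner (∑ i, vecMulVec (u i) (v i)) X = ∑ i, σ i := by
  rw [h.frobInner_eq_sum]
  refine Finset.sum_congr rfl fun i _ => ?_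
  rw [h.polar_mulVec_self, h.mulVec, dotProduct_smul, smul_eq_mul]
  rcases (h.nonneg i).lt_or_eq with hi | hi
  · rw [h.unit i hi, mul_one]
  · simp [← hi]

theorem polar_contraction (h : IsSVD X σ v u) (x : Fin n → ℝ) :
    (∑ i, vecMulVec (u i) (v i)) *ᵥ x ⬝ᵥ (∑ i, vecMulVec (u i) (v i)) *ᵥ x ≤ x ⬝ᵥ x := by
  rw [h.polar_mulVec_sq, h.dotProduct_self_eq_sum]
  exact Finset.sum_le_sum fun i _ => mul_le_of_le_one_right (sq_nonneg _) (h.unit_le i)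

end IsSVD

theorem rank_eq_finrank_range_toEuclideanLin (X : Matrix (Fin m) (Fin n) ℝ) :
    X.rank = Module.finrank ℝ (LinearMap.range (toEuclideanLin X)) := by
  rw [toEuclideanLin_eq_toLin_orthonormal]
  exact X.rank_eq_finrank_range_toLin _ _

theorem singularValues_pos_iff (X : Matrix (Fin m) (Fin n) ℝ) (i : ℕ) :
    0 < (toEuclideanLin X).singularValues i ↔ i < X.rank := by
  rw [rank_eq_finrank_range_toEuclideanLin, LinearMap.singularValues_pos_iff_lt_finrank_range]

theorem singularValues_eq_zero_iff_rank_le (X : Matrix (Fin m) (Fin n) ℝ) (i : ℕ) :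
    (toEuclideanLin X).singularValues i = 0 ↔ X.rank ≤ i := by
  rw [rank_eq_finrank_range_toEuclideanLin,
    LinearMap.singularValues_eq_zero_iff_le_finrank_range]

theorem nuclearNorm_eq_sum (X : Matrix (Fin m) (Fin n) ℝ) :
    nuclearNorm X = ∑ i : Fin n, (toEuclideanLin X).singularValues i := by
  rw [Fin.sum_univ_eq_sum_range (fun i => (toEuclideanLin X).singularValues i), nuclearNorm,
    Finset.range_eq_Ico, ← Finset.Ico_add_one_right_eq_Icc,
    Finset.sum_Ico_eq_sum_range, Finset.range_eq_Ico]
  simp only [singVal, add_tsub_cancel_left, add_tsub_cancel_right]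
  -- The extra indices are at least `m`, hence beyond the rank.
  refine Finset.sum_subset (Finset.Ico_subset_Ico le_rfl (min_le_right _ _)) fun i hi hi' => ?_
  rw [singularValues_eq_zero_iff_rank_le]
  have h1 := X.rank_le_height
  simp only [Finset.mem_Ico] at hi hi'
  omega

theorem frobInner_le_nuclearNorm {Z X : Matrix (Fin m) (Fin n) ℝ} {c : ℝ} (hc : 0 ≤ c)
    (hZ : ∀ x, Z *ᵥ x ⬝ᵥ Z *ᵥ x ≤ c ^ 2 * (x ⬝ᵥ x)) :
    frobInner Z X ≤ c * nuclearNorm X := by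
  obtain ⟨v, u, h⟩ := exists_isSVD X
  rw [nuclearNorm_eq_sum]
  exact h.frobInner_le hc hZ

theorem exists_frobInner_eq_nuclearNorm (X : Matrix (Fin m) (Fin n) ℝ) :
    ∃ Z : Matrix (Fin m) (Fin n) ℝ, (∀ x, Z *ᵥ x ⬝ᵥ Z *ᵥ x ≤ x ⬝ᵥ x) ∧
      frobInner Z X = nuclearNorm X := by
  obtain ⟨v, u, h⟩ := exists_isSVD X
  exact ⟨_, h.polar_contraction, by rw [h.frobInner_polar, nuclearNorm_eq_sum]⟩

/-- The contraction that norms the intermediate point is a linear lower bound for the nuclear norm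
at both endpoints. -/
theorem nuclearNorm_convex (X Y : Matrix (Fin m) (Fin n) ℝ) {t : ℝ} (h0 : 0 ≤ t) (h1 : t ≤ 1) :
    nuclearNorm (Y + t • (X - Y)) ≤ nuclearNorm Y + t * (nuclearNorm X - nuclearNorm Y) := by
  obtain ⟨Z, hZ, hZX⟩ := exists_frobInner_eq_nuclearNorm (Y + t • (X - Y))
  have hle : ∀ W : Matrix (Fin m) (Fin n) ℝ, frobInner Z W ≤ nuclearNorm W := fun W => by
    simpa using frobInner_le_nuclearNorm (Z := Z) (X := W) zero_le_one (by simpa using hZ)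
  rw [← hZX, frobInner_add_right, frobInner_smul_right, frobInner_sub_right]
  nlinarith [hle X, hle Y]

/-- For a norming contraction `Z`, `⟨Z, A Bᵀ⟩ = ⟨Z B, A⟩`; then apply `2⟨P, Q⟩ ≤ ‖P‖² + ‖Q‖²`. -/
theorem nuclearNorm_mul_transpose_le (A : Matrix (Fin m) (Fin k) ℝ)
    (B : Matrix (Fin n) (Fin k) ℝ) :
    nuclearNorm (A * Bᵀ) ≤ (‖A‖ ^ 2 + ‖B‖ ^ 2) / 2 := by
  obtain ⟨Z, hZ, hZX⟩ := exists_frobInner_eq_nuclearNorm (A * Bᵀ)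
  have h1 : ‖Z * B‖ ^ 2 ≤ ‖B‖ ^ 2 := by
    rw [norm_sq_eq_frobInner, norm_sq_eq_frobInner, frobInner_eq_sum_col, frobInner_eq_sum_col]
    exact Finset.sum_le_sum fun j _ => hZ (Bᵀ j)
  have h2 := norm_sub_sq_eq_frobInner (Z * B) A
  rw [← hZX, frobInner_mul_transpose]
  nlinarith [sq_nonneg ‖Z * B - A‖]

end SingularValues

/-! ### Splitting along the singular spaces of `X`, and low-rank approximation. -/

section RankBounds

variable {m n k : ℕ}

namespace IsSVD

variable {X : Matrix (Fin m) (Fin n) ℝ} {σ : Fin n → ℝ} {v : Fin n → Fin n → ℝ}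
  {u : Fin n → Fin m → ℝ}

theorem norm_sq (h : IsSVD X σ v u) : ‖X‖ ^ 2 = ∑ i, σ i ^ 2 := by
  rw [norm_sq_eq_frobInner, h.frobInner_eq_sum]
  refine Finset.sum_congr rfl fun i _ => ?_
  simp [h.mulVec_dotProduct_self, h.orthonormal]

/-- The part of `T` that acts on the orthogonal complements of the column and row spaces of `X`,
normalized by a bound `γ` for the operator norm of `T`, given that `T` acts as `lam` times the polar
factor of `X` on these spaces themselves. -/
theorem exists_complement_part (h : IsSVD X σ v u) {T : Matrix (Fin m) (Fin n) ℝ} {lam γ : ℝ}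
    (hγ : 0 < γ) (hTv : ∀ j, 0 < σ j → T *ᵥ v j = lam • u j)
    (hTu : ∀ j, 0 < σ j → Tᵀ *ᵥ u j = lam • v j)
    (hT : ∀ x, T *ᵥ x ⬝ᵥ T *ᵥ x ≤ γ ^ 2 * (x ⬝ᵥ x)) :
    ∃ W : Matrix (Fin m) (Fin n) ℝ, (∀ j x, u j ⬝ᵥ W *ᵥ x = 0) ∧
      (∀ x, W *ᵥ x ⬝ᵥ W *ᵥ x + ∑ j, (v j ⬝ᵥ x) ^ 2 * (u j ⬝ᵥ u j) ≤ x ⬝ᵥ x) ∧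
      T = lam • ∑ i, vecMulVec (u i) (v i) + γ • W := by
  set K := ∑ i, vecMulVec (u i) (v i) with hK
  refine ⟨γ⁻¹ • (T - lam • K), ?_, ?_, ?_⟩
  · intro j x
    rcases (h.nonneg j).lt_or_eq with hj | hj
    · have h1 : u j ⬝ᵥ T *ᵥ x = lam * (v j ⬝ᵥ x) := by
        rw [dotProduct_mulVec_transpose, hTu j hj, smul_dotProduct, smul_eq_mul]
      have h2 : u j ⬝ᵥ K *ᵥ x = v j ⬝ᵥ x := by
        rw [hK, polar_mulVec, dotProduct_sum, Finset.sum_eq_single j]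
        · simp [h.unit j hj]
        · intro i _ hi
          simp [h.orthogonal j i hi.symm]
        · simp
      rw [smul_mulVec, sub_mulVec, smul_mulVec]
      simp [dotProduct_sub, h1, h2]
    · simp [h.zero j hj.symm]
  · intro x
    -- As `u j ⬝ᵥ u j` is `0` or `1`, these are the coordinates of the projection of `x` onto `ker
    -- X`; there `T - lam K` agrees with `T`, and elsewhere it vanishes.
    set d : Fin n → ℝ := fun j => (1 - u j ⬝ᵥ u j) * (v j ⬝ᵥ x) with hd
    have hW : (T - lam • K) *ᵥ x = T *ᵥ (∑ j, d j • v j) := by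
      rw [h.mulVec_eq_sum (T - lam • K), Matrix.mulVec_sum]
      refine Finset.sum_congr rfl fun j _ => ?_
      rw [mulVec_smul, sub_mulVec, smul_mulVec, hK, h.polar_mulVec_self]
      rcases (h.nonneg j).lt_or_eq with hj | hj
      · simp [hTv j hj, hd, h.unit j hj]
      · simp [h.zero j hj.symm, hd]
    have hdd : (∑ j, d j • v j) ⬝ᵥ (∑ j, d j • v j) =
        ∑ j, ((v j ⬝ᵥ x) ^ 2 - (v j ⬝ᵥ x) ^ 2 * (u j ⬝ᵥ u j)) := by
      rw [h.dotProduct_self_eq_sum]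
      refine Finset.sum_congr rfl fun j _ => ?_
      have : v j ⬝ᵥ ∑ i, d i • v i = d j := by
        simp [dotProduct_sum, h.orthonormal]
      rw [this, hd]
      rcases (h.nonneg j).lt_or_eq with hj | hj
      · simp [h.unit j hj]
      · simp [h.zero j hj.symm]
    have h1 := hT (∑ j, d j • v j)
    rw [hdd, Finset.sum_sub_distrib, ← h.dotProduct_self_eq_sum] at h1
    rw [smul_mulVec, hW, smul_dotProduct, dotProduct_smul, smul_eq_mul, smul_eq_mul, ← mul_assoc,
      ← sq, inv_pow, ← le_sub_iff_add_le, inv_mul_le_iff₀ (by positivity)]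
    exact h1
  · rw [smul_inv_smul₀ hγ.ne']
    abel

/-- The ranges of `K` and `W` are orthogonal, so `K + W` is a contraction; write `T = lam (K + W) +
(γ - lam) W` and use duality. -/
theorem frobInner_le_nuclearNorm_add (h : IsSVD X σ v u) {T W : Matrix (Fin m) (Fin n) ℝ}
    {lam γ : ℝ} (hlam : 0 ≤ lam) (hWu : ∀ j x, u j ⬝ᵥ W *ᵥ x = 0)
    (hW : ∀ x, W *ᵥ x ⬝ᵥ W *ᵥ x + ∑ j, (v j ⬝ᵥ x) ^ 2 * (u j ⬝ᵥ u j) ≤ x ⬝ᵥ x)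
    (hT : T = lam • ∑ i, vecMulVec (u i) (v i) + γ • W) (Y : Matrix (Fin m) (Fin n) ℝ) :
    frobInner T Y ≤ lam * nuclearNorm Y + (γ - lam) * frobInner W Y := by
  set K := ∑ i, vecMulVec (u i) (v i) with hK
  have hKW : frobInner (K + W) Y ≤ 1 * nuclearNorm Y := by
    refine frobInner_le_nuclearNorm zero_le_one fun x => ?_
    have h1 : K *ᵥ x ⬝ᵥ W *ᵥ x = 0 := by
      rw [hK, polar_mulVec, sum_dotProduct]
      simp [hWu]
    have h2 := hW x
    rw [← h.polar_mulVec_sq] at h2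
    rw [add_mulVec, dotProduct_add, add_dotProduct, add_dotProduct, h1,
      dotProduct_comm (W *ᵥ x) (K *ᵥ x), h1]
    linarith
  have : T = lam • (K + W) + (γ - lam) • W := by
    rw [hT, smul_add, sub_smul]
    abel
  rw [this, frobInner_add_left, frobInner_smul_left, frobInner_smul_left]
  nlinarith

/-- An Eckart–Young type lower bound for the distance of `X` to a matrix `Y` of rank at most
`#J`, which accounts for the part of `Y` outside the column and row spaces of `X`. -/
theorem two_mul_frobInner_le (h : IsSVD X σ v u) {W : Matrix (Fin m) (Fin n) ℝ}
    (hWu : ∀ j x, u j ⬝ᵥ W *ᵥ x = 0)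
    (hW : ∀ x, W *ᵥ x ⬝ᵥ W *ᵥ x + ∑ j, (v j ⬝ᵥ x) ^ 2 * (u j ⬝ᵥ u j) ≤ x ⬝ᵥ x)
    (J : Finset (Fin n)) {s : ℝ} (hs : 0 ≤ s) (hJ : ∀ j ∈ J, s ≤ σ j) (hJ' : ∀ j ∉ J, σ j ≤ s)
    {Y : Matrix (Fin m) (Fin n) ℝ} {τ : Fin n → ℝ} {q : Fin n → Fin n → ℝ}
    {p : Fin n → Fin m → ℝ} (hY : IsSVD Y τ q p) (hYJ : ∀ i ∉ J, τ i = 0) :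
    2 * s * frobInner W Y ≤ ‖X - Y‖ ^ 2 - ∑ i ∈ Jᶜ, σ i ^ 2 := by
  have hXW : ∀ x, X *ᵥ x ⬝ᵥ W *ᵥ x = 0 := by
    intro x
    rw [h.mulVec_eq_sum X, sum_dotProduct]
    simp [h.mulVec, hWu]
  -- The left side is `‖(X + s W) x‖²`. Adding `s W` fills the complement with singular values at
  -- most `s`, so those above `s` still come from `J`.
  have hbound : ∀ x, X *ᵥ x ⬝ᵥ X *ᵥ x + s ^ 2 * (W *ᵥ x ⬝ᵥ W *ᵥ x) ≤
      s ^ 2 * (x ⬝ᵥ x) + ∑ j ∈ J, (σ j ^ 2 - s ^ 2) * (v j ⬝ᵥ x) ^ 2 := by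
    intro x
    have h1 : s ^ 2 * (W *ᵥ x ⬝ᵥ W *ᵥ x) ≤
        s ^ 2 * (x ⬝ᵥ x - ∑ j, (v j ⬝ᵥ x) ^ 2 * (u j ⬝ᵥ u j)) :=
      mul_le_mul_of_nonneg_left (by linarith [hW x]) (sq_nonneg s)
    have h2 : ∑ j, σ j ^ 2 * (v j ⬝ᵥ x) ^ 2 ≤
        s ^ 2 * ∑ j, (v j ⬝ᵥ x) ^ 2 * (u j ⬝ᵥ u j) +
          ∑ j ∈ J, (σ j ^ 2 - s ^ 2) * (v j ⬝ᵥ x) ^ 2 := by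
      rw [← Fintype.sum_ite_mem J, Finset.mul_sum, ← Finset.sum_add_distrib]
      refine Finset.sum_le_sum fun j _ => ?_
      rcases (h.nonneg j).lt_or_eq with hj | hj
      · rw [h.unit j hj]
        split_ifs with hjJ
        · exact le_of_eq (by ring)
        · have : σ j ^ 2 ≤ s ^ 2 := pow_le_pow_left₀ hj.le (hJ' j hjJ) 2
          nlinarith [sq_nonneg (v j ⬝ᵥ x)]
      · split_ifs with hjJ
        · have : s = 0 := le_antisymm ((hJ j hjJ).trans hj.ge) hs
          simp [this]
        · simp [← hj, h.zero j hj.symm]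
    rw [h.mulVec_dotProduct_self]
    linarith
  -- Ky Fan's argument: exchange the sums and use Bessel's inequality for the orthonormal `q i`, the
  -- weights `σ j ^ 2 - s ^ 2` being nonnegative on `J`.
  have hsum : ∑ i ∈ J, (X *ᵥ q i ⬝ᵥ X *ᵥ q i + s ^ 2 * (W *ᵥ q i ⬝ᵥ W *ᵥ q i)) ≤
      ∑ i ∈ J, σ i ^ 2 := by
    calc _ ≤ ∑ i ∈ J, (s ^ 2 + ∑ j ∈ J, (σ j ^ 2 - s ^ 2) * (v j ⬝ᵥ q i) ^ 2) := by
          refine Finset.sum_le_sum fun i _ => ?_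
          simpa [hY.orthonormal] using hbound (q i)
      _ = ∑ j ∈ J, (s ^ 2 + (σ j ^ 2 - s ^ 2) * ∑ i ∈ J, (v j ⬝ᵥ q i) ^ 2) := by
          rw [Finset.sum_add_distrib, Finset.sum_add_distrib, Finset.sum_comm]
          simp only [Finset.mul_sum]
      _ ≤ _ := by
          refine Finset.sum_le_sum fun j hj => ?_
          have h1 : ∑ i ∈ J, (v j ⬝ᵥ q i) ^ 2 ≤ 1 := by
            have h2 := hY.dotProduct_self_eq_sum (v j)
            rw [h.orthonormal, if_pos rfl] at h2
            rw [h2]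
            simp only [dotProduct_comm (v j)]
            exact Finset.sum_le_univ_sum_of_nonneg fun i => sq_nonneg _
          have h2 : s ^ 2 ≤ σ j ^ 2 := pow_le_pow_left₀ hs (hJ j hj) 2
          nlinarith
  have hYz : ∀ i ∉ J, Y *ᵥ q i = 0 := fun i hi => by rw [hY.mulVec, hYJ i hi, zero_smul]
  have hinner : ∀ Z : Matrix (Fin m) (Fin n) ℝ,
      frobInner Z Y = ∑ i ∈ J, Z *ᵥ q i ⬝ᵥ Y *ᵥ q i := by
    intro Z
    rw [hY.frobInner_eq_sum]
    refine (Finset.sum_subset (Finset.subset_univ J) fun i _ hi => ?_).symm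
    rw [hYz i hi, dotProduct_zero]
  -- Expand `‖(X + s W - Y) q i‖² ≥ 0`; only `i ∈ J` contributes, because `Y` kills the other `q i`.
  have hAM : 2 * frobInner X Y + 2 * s * frobInner W Y ≤ ‖Y‖ ^ 2 +
      ∑ i ∈ J, (X *ᵥ q i ⬝ᵥ X *ᵥ q i + s ^ 2 * (W *ᵥ q i ⬝ᵥ W *ᵥ q i)) := by
    rw [norm_sq_eq_frobInner, hinner X, hinner W, hinner Y, Finset.mul_sum, Finset.mul_sum,
      ← Finset.sum_add_distrib, ← Finset.sum_add_distrib]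
    refine Finset.sum_le_sum fun i _ => ?_
    have h1 := dotProduct_self_nonneg' (X *ᵥ q i + s • W *ᵥ q i - Y *ᵥ q i)
    simp only [dotProduct_add, add_dotProduct, dotProduct_sub, sub_dotProduct, smul_dotProduct,
      dotProduct_smul, smul_eq_mul] at h1
    rw [dotProduct_comm (Y *ᵥ q i) (X *ᵥ q i), dotProduct_comm (Y *ᵥ q i) (W *ᵥ q i),
      dotProduct_comm (W *ᵥ q i) (X *ᵥ q i), hXW] at h1
    linarith
  rw [norm_sub_sq_eq_frobInner, h.norm_sq, ← Finset.sum_add_sum_compl J]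
  linarith

/-- The truncated singular value decomposition. -/
theorem exists_rank_le (h : IsSVD X σ v u) (J : Finset (Fin n)) :
    ∃ Y : Matrix (Fin m) (Fin n) ℝ, Y.rank ≤ J.card ∧ ‖X - Y‖ ^ 2 = ∑ i ∈ Jᶜ, σ i ^ 2 := by
  let C : Matrix (Fin m) J ℝ := Matrix.of fun a i => (X *ᵥ v i) a
  let R : Matrix J (Fin n) ℝ := Matrix.of fun i b => v i b
  refine ⟨C * R, (rank_mul_le_right _ _).trans ((rank_le_card_height R).trans (by simp)), ?_⟩
  have hCR : ∀ j, (C * R) *ᵥ v j = if j ∈ J then X *ᵥ v j else 0 := by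
    intro j
    have hR : R *ᵥ v j = fun i : J => if (i : Fin n) = j then (1 : ℝ) else 0 := by
      ext i
      exact h.orthonormal i j
    rw [← mulVec_mulVec, hR]
    ext a
    have : (C *ᵥ fun i : J => if (i : Fin n) = j then (1 : ℝ) else 0) a =
        ∑ i : J, (fun i : Fin n => if i = j then (X *ᵥ v i) a else 0) i := by
      change ∑ i : J, (X *ᵥ v i) a * (if (i : Fin n) = j then (1 : ℝ) else 0) = _
      simp only [mul_ite, mul_one, mul_zero]
    rw [this, Finset.sum_coe_sort J (fun i : Fin n => if i = j then (X *ᵥ v i) a else 0),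
      Finset.sum_ite_eq']
    split_ifs <;> rfl
  rw [norm_sq_eq_frobInner, h.frobInner_eq_sum, ← Finset.sum_add_sum_compl J]
  have h1 : ∑ j ∈ J, (X - C * R) *ᵥ v j ⬝ᵥ (X - C * R) *ᵥ v j = 0 := by
    refine Finset.sum_eq_zero fun j hj => ?_
    rw [sub_mulVec, hCR, if_pos hj]
    simp
  rw [h1, zero_add]
  refine Finset.sum_congr rfl fun j hj => ?_
  rw [sub_mulVec, hCR, if_neg (Finset.mem_compl.1 hj), sub_zero]
  simp [h.mulVec_dotProduct_self, h.orthonormal]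

end IsSVD

/-- The Gram matrices are invertible, so `Aᵀ (A Bᵀ) B` already has rank `k`. -/
theorem rank_mul_transpose_of_injective {A : Matrix (Fin m) (Fin k) ℝ}
    {B : Matrix (Fin n) (Fin k) ℝ} (hA : ∀ x, A *ᵥ x = 0 → x = 0) (hB : ∀ x, B *ᵥ x = 0 → x = 0) :
    (A * Bᵀ).rank = k := by
  have key : ∀ {l : ℕ} (M : Matrix (Fin l) (Fin k) ℝ), (∀ x, M *ᵥ x = 0 → x = 0) →
      IsUnit (Mᵀ * M) := by
    intro l M hM
    rw [← mulVec_injective_iff_isUnit]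
    refine (injective_iff_map_eq_zero (Mᵀ * M).mulVecLin).2 fun x hx => hM x ?_
    rw [mulVecLin_apply, ← mulVec_mulVec] at hx
    rw [← dotProduct_self_eq_zero, dotProduct_mulVec_transpose, hx, zero_dotProduct]
  refine le_antisymm ((rank_mul_le_left _ _).trans A.rank_le_width) ?_
  have h1 : (Aᵀ * (A * Bᵀ) * B).rank = k := by
    have : Aᵀ * (A * Bᵀ) * B = (Aᵀ * A) * (Bᵀ * B) := by simp only [Matrix.mul_assoc]
    rw [this, rank_of_isUnit _ ((key A hA).mul (key B hB)), Fintype.card_fin]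
  calc k = _ := h1.symm
    _ ≤ _ := (rank_mul_le_left _ _).trans (rank_mul_le_right _ _)

end RankBounds

/-! ### First and second derivatives of the LoRA loss. -/

section Calculus

variable {m n k : ℕ}

theorem hasDerivAt_parabola {E : Type*} [NormedAddCommGroup E] [NormedSpace ℝ E] (x d e : E) :
    HasDerivAt (fun t : ℝ => x + t • d + t ^ 2 • e) d 0 := by
  have h1 : HasDerivAt (fun t : ℝ => x + t • d + t ^ 2 • e) _ 0 :=
    (((hasDerivAt_id (0 : ℝ)).smul_const d).const_add x).add
      ((hasDerivAt_pow 2 (0 : ℝ)).smul_const e)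
  exact h1.congr_deriv (by simp)

theorem hasDerivAt_line {E : Type*} [NormedAddCommGroup E] [NormedSpace ℝ E] (x d : E) :
    HasDerivAt (fun t : ℝ => x + t • d) d 0 := by
  simpa using hasDerivAt_parabola x d 0

/-- A line in the factors `(A, B)` is mapped to such a parabola by `A Bᵀ`; the curvature `e`
contributes the first-order term of the Hessian. -/
theorem hasDerivAt_fderiv_parabola {E : Type*} [NormedAddCommGroup E] [NormedSpace ℝ E] {f : E → ℝ}
    {x : E} (hf : DifferentiableAt ℝ (fderiv ℝ f) x) (d e : E) :
    HasDerivAt (fun t : ℝ => fderiv ℝ f (x + t • d + t ^ 2 • e) (d + (2 * t) • e))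
      (hessQuad f x d + 2 * fderiv ℝ f x e) 0 := by
  have hY : HasDerivAt (fun t : ℝ => d + (2 * t) • e) ((2 : ℝ) • e) 0 := by
    have h1 : HasDerivAt (fun t : ℝ => d + (2 * t) • e) _ 0 :=
      (((hasDerivAt_id (0 : ℝ)).const_mul 2).smul_const e).const_add d
    exact h1.congr_deriv (by simp)
  have hX : HasDerivAt (fun t : ℝ => fderiv ℝ f (x + t • d + t ^ 2 • e))
      (fderiv ℝ (fderiv ℝ f) x d) 0 :=
    hf.hasFDerivAt.comp_hasDerivAt_of_eq (0 : ℝ) (hasDerivAt_parabola x d e) (by simp)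
  have h := hX.clm_apply hY
  refine h.congr_deriv ?_
  rw [hessQuad]
  simp

theorem hasDerivAt_fderiv_line {E : Type*} [NormedAddCommGroup E] [NormedSpace ℝ E] {f : E → ℝ}
    {x : E} (hf : DifferentiableAt ℝ (fderiv ℝ f) x) (d : E) :
    HasDerivAt (fun t : ℝ => fderiv ℝ f (x + t • d) d) (hessQuad f x d) 0 := by
  simpa using hasDerivAt_fderiv_parabola hf d 0

theorem hasDerivAt_add_line {E : Type*} [NormedAddCommGroup E] [NormedSpace ℝ E] {f : E → ℝ}
    {x : E} (hf : DifferentiableAt ℝ f x) (d : E) (c : ℝ) :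
    HasDerivAt (fun t : ℝ => f (x + t • d) + t * c) (fderiv ℝ f x d + c) 0 := by
  have hd : HasFDerivAt f (fderiv ℝ f x) (x + (0 : ℝ) • d) := by
    simpa using hf.hasFDerivAt
  exact (hd.comp_hasDerivAt (0 : ℝ) (hasDerivAt_line x d)).add (hasDerivAt_mul_const c)

theorem fderiv_bilinear_apply {E F G : Type*} [NormedAddCommGroup E] [NormedSpace ℝ E]
    [NormedAddCommGroup F] [NormedSpace ℝ F] [NormedAddCommGroup G] [NormedSpace ℝ G]
    (b : E →L[ℝ] F →L[ℝ] G) (p d : E × F) :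
    fderiv ℝ (fun p : E × F => b p.1 p.2) p d = b d.1 p.2 + b p.1 d.2 := by
  rw [(b.hasFDerivAt_of_bilinear (hasFDerivAt_fst (p := p)) (hasFDerivAt_snd (p := p))).fderiv]
  simp [add_comm]

theorem fderiv_quadratic_apply {E F : Type*} [NormedAddCommGroup E] [NormedSpace ℝ E]
    [NormedAddCommGroup F] [NormedSpace ℝ F] (b : E →L[ℝ] E →L[ℝ] ℝ) (b' : F →L[ℝ] F →L[ℝ] ℝ)
    (c : ℝ) (p d : E × F) :
    fderiv ℝ (fun p : E × F => c * (b p.1 p.1 + b' p.2 p.2)) p d =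
      c * (b p.1 d.1 + b d.1 p.1 + (b' p.2 d.2 + b' d.2 p.2)) := by
  have h1 := b.hasFDerivAt_of_bilinear (hasFDerivAt_fst (𝕜 := ℝ) (p := p))
    (hasFDerivAt_fst (𝕜 := ℝ) (p := p))
  have h2 := b'.hasFDerivAt_of_bilinear (hasFDerivAt_snd (𝕜 := ℝ) (p := p))
    (hasFDerivAt_snd (𝕜 := ℝ) (p := p))
  have h : HasFDerivAt (fun p : E × F => c * (b p.1 p.1 + b' p.2 p.2)) _ p :=
    (h1.add h2).const_mul c
  rw [h.fderiv]
  simp [mul_add]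

theorem frobInner_grad (f : Matrix (Fin m) (Fin n) ℝ → ℝ) (X Y : Matrix (Fin m) (Fin n) ℝ) :
    frobInner (grad f X) Y = fderiv ℝ f X Y := by
  conv_rhs => rw [matrix_eq_sum_single Y]
  simp only [map_sum, frobInner_eq_sum_row, dotProduct]
  refine Finset.sum_congr rfl fun i _ => Finset.sum_congr rfl fun j _ => ?_
  have : single i j (Y i j) = Y i j • single i j (1 : ℝ) := by simp [smul_single]
  rw [this, map_smul, smul_eq_mul, mul_comm]
  rfl

/-- `(A, B) ↦ A Bᵀ` as a continuous bilinear map. -/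
noncomputable def mulTransposeCLM (m n k : ℕ) : Matrix (Fin m) (Fin k) ℝ →L[ℝ]
    Matrix (Fin n) (Fin k) ℝ →L[ℝ] Matrix (Fin m) (Fin n) ℝ :=
  (LinearMap.mk₂ ℝ (fun (A : Matrix (Fin m) (Fin k) ℝ) (B : Matrix (Fin n) (Fin k) ℝ) => A * Bᵀ)
    (by simp [Matrix.add_mul]) (by simp) (by simp [Matrix.mul_add])
    (by simp)).toContinuousBilinearMap

theorem mulTransposeCLM_apply (A : Matrix (Fin m) (Fin k) ℝ) (B : Matrix (Fin n) (Fin k) ℝ) :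
    mulTransposeCLM m n k A B = A * Bᵀ := rfl

/-- The matrix inner product as a continuous bilinear map. -/
noncomputable def frobInnerCLM (m n : ℕ) : Matrix (Fin m) (Fin n) ℝ →L[ℝ]
    Matrix (Fin m) (Fin n) ℝ →L[ℝ] ℝ :=
  (LinearMap.mk₂ ℝ (fun A B : Matrix (Fin m) (Fin n) ℝ => frobInner A B)
    frobInner_add_left frobInner_smul_left frobInner_add_right
    frobInner_smul_right).toContinuousBilinearMap

theorem frobInnerCLM_apply (A B : Matrix (Fin m) (Fin n) ℝ) :
    frobInnerCLM m n A B = frobInner A B := rfl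

section Lora

variable {L : Matrix (Fin m) (Fin n) ℝ → ℝ} {r : ℕ} {lam : ℝ}

/-- The factorization map `(A, B) ↦ A Bᵀ`. -/
noncomputable def factorMap (m n r : ℕ)
    (p : Matrix (Fin m) (Fin r) ℝ × Matrix (Fin n) (Fin r) ℝ) : Matrix (Fin m) (Fin n) ℝ :=
  mulTransposeCLM m n r p.1 p.2

/-- The weight decay term of the LoRA loss. -/
noncomputable def weightDecay (m n r : ℕ) (lam : ℝ)
    (p : Matrix (Fin m) (Fin r) ℝ × Matrix (Fin n) (Fin r) ℝ) : ℝ :=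
  lam / 2 * (frobInnerCLM m r p.1 p.1 + frobInnerCLM n r p.2 p.2)

theorem regLora_eq : regLora r lam L = fun p => L (factorMap m n r p) + weightDecay m n r lam p := by
  funext p
  simp only [regLora, factorMap, weightDecay, norm_sq_eq_frobInner, mulTransposeCLM_apply,
    frobInnerCLM_apply]

theorem contDiff_factorMap : ContDiff ℝ 2 (factorMap m n r) := by
  unfold factorMap
  fun_prop

theorem contDiff_weightDecay : ContDiff ℝ 2 (weightDecay m n r lam) := by
  unfold weightDecay
  fun_prop

theorem fderiv_factorMap_apply (p d : Matrix (Fin m) (Fin r) ℝ × Matrix (Fin n) (Fin r) ℝ) :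
    fderiv ℝ (factorMap m n r) p d = d.1 * p.2ᵀ + p.1 * d.2ᵀ :=
  fderiv_bilinear_apply (mulTransposeCLM m n r) p d

theorem fderiv_weightDecay_apply (p d : Matrix (Fin m) (Fin r) ℝ × Matrix (Fin n) (Fin r) ℝ) :
    fderiv ℝ (weightDecay m n r lam) p d = lam * (frobInner p.1 d.1 + frobInner p.2 d.2) := by
  have h : fderiv ℝ (weightDecay m n r lam) p d = lam / 2 * (frobInner p.1 d.1 +
      frobInner d.1 p.1 + (frobInner p.2 d.2 + frobInner d.2 p.2)) :=
    fderiv_quadratic_apply (frobInnerCLM m r) (frobInnerCLM n r) (lam / 2) p d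
  rw [h, frobInner_comm d.1, frobInner_comm d.2]
  ring

theorem fderiv_regLora (hL : Differentiable ℝ L) :
    fderiv ℝ (regLora r lam L) = fun p =>
      (fderiv ℝ L (factorMap m n r p)).comp (fderiv ℝ (factorMap m n r) p) +
        fderiv ℝ (weightDecay m n r lam) p := by
  funext p
  rw [regLora_eq]
  have h1 : HasFDerivAt (factorMap m n r) _ p :=
    (contDiff_factorMap.differentiable two_ne_zero p).hasFDerivAt
  have h2 : HasFDerivAt (weightDecay m n r lam) _ p :=
    (contDiff_weightDecay.differentiable two_ne_zero p).hasFDerivAt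
  exact (((hL _).hasFDerivAt.comp p h1).add h2).fderiv

theorem fderiv_regLora_apply (hL : Differentiable ℝ L)
    (p d : Matrix (Fin m) (Fin r) ℝ × Matrix (Fin n) (Fin r) ℝ) :
    fderiv ℝ (regLora r lam L) p d = fderiv ℝ L (p.1 * p.2ᵀ) (d.1 * p.2ᵀ + p.1 * d.2ᵀ) +
      lam * (frobInner p.1 d.1 + frobInner p.2 d.2) := by
  rw [fderiv_regLora hL]
  simp only [_root_.add_apply, ContinuousLinearMap.comp_apply,
    fderiv_factorMap_apply, fderiv_weightDecay_apply]
  rfl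

theorem differentiable_fderiv_regLora (hL : TwiceDifferentiable L) :
    Differentiable ℝ (fderiv ℝ (regLora r lam L)) := by
  rw [fderiv_regLora hL.1]
  have h1 : Differentiable ℝ (fderiv ℝ (factorMap m n r)) :=
    (contDiff_factorMap.fderiv_right (m := 1) le_rfl).differentiable one_ne_zero
  have h2 : Differentiable ℝ (fderiv ℝ (weightDecay m n r lam)) :=
    (contDiff_weightDecay.fderiv_right (m := 1) le_rfl).differentiable one_ne_zero
  have h3 : Differentiable ℝ (factorMap m n r) := contDiff_factorMap.differentiable two_ne_zero
  exact ((hL.2.comp h3).clm_comp h1).add h2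

theorem hessQuad_regLora (hL : TwiceDifferentiable L) (A P : Matrix (Fin m) (Fin r) ℝ)
    (B Q : Matrix (Fin n) (Fin r) ℝ) :
    hessQuad (regLora r lam L) (A, B) (P, Q) =
      hessQuad L (A * Bᵀ) (P * Bᵀ + A * Qᵀ) + 2 * fderiv ℝ L (A * Bᵀ) (P * Qᵀ) +
        lam * (‖P‖ ^ 2 + ‖Q‖ ^ 2) := by
  have h1 := hasDerivAt_fderiv_line (differentiable_fderiv_regLora (lam := lam) hL (A, B)) (P, Q)
  have hc : HasDerivAt (fun t : ℝ => lam * (frobInner A P + frobInner B Q +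
      t * (‖P‖ ^ 2 + ‖Q‖ ^ 2))) (lam * (‖P‖ ^ 2 + ‖Q‖ ^ 2)) 0 := by
    simpa using (((hasDerivAt_id (0 : ℝ)).mul_const (‖P‖ ^ 2 + ‖Q‖ ^ 2)).const_add
      (frobInner A P + frobInner B Q)).const_mul lam
  have h2 := (hasDerivAt_fderiv_parabola (hL.2 (A * Bᵀ)) (P * Bᵀ + A * Qᵀ) (P * Qᵀ)).add hc
  refine h1.unique (h2.congr_of_eventuallyEq (Filter.Eventually.of_forall fun t => ?_))
  have e : fderiv ℝ (regLora r lam L) (A + t • P, B + t • Q) (P, Q) =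
      fderiv ℝ L (A * Bᵀ + t • (P * Bᵀ + A * Qᵀ) + t ^ 2 • (P * Qᵀ))
        (P * Bᵀ + A * Qᵀ + (2 * t) • (P * Qᵀ)) + lam * (frobInner A P + frobInner B Q +
          t * (‖P‖ ^ 2 + ‖Q‖ ^ 2)) := by
    rw [fderiv_regLora_apply hL.1]
    simp only [norm_sq_eq_frobInner]
    have e1 : (A + t • P) * (B + t • Q)ᵀ =
        A * Bᵀ + t • (P * Bᵀ + A * Qᵀ) + t ^ 2 • (P * Qᵀ) := by
      simp only [transpose_add, transpose_smul, Matrix.add_mul, Matrix.mul_add, Matrix.smul_mul,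
        Matrix.mul_smul, smul_add, smul_smul, sq]
      abel
    have e2 : P * (B + t • Q)ᵀ + (A + t • P) * Qᵀ =
        P * Bᵀ + A * Qᵀ + (2 * t) • (P * Qᵀ) := by
      simp only [transpose_add, transpose_smul, Matrix.add_mul, Matrix.mul_add, Matrix.smul_mul,
        Matrix.mul_smul, two_mul, add_smul]
      abel
    rw [e1, e2]
    simp only [frobInner_add_left, frobInner_smul_left]
    ring
  exact e

theorem grad_mul_of_fderiv_regLora_eq_zero (hL : Differentiable ℝ L)
    {A : Matrix (Fin m) (Fin r) ℝ} {B : Matrix (Fin n) (Fin r) ℝ}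
    (h : fderiv ℝ (regLora r lam L) (A, B) = 0) :
    -grad L (A * Bᵀ) * B = lam • A ∧ (-grad L (A * Bᵀ))ᵀ * A = lam • B := by
  set G := grad L (A * Bᵀ) with hG
  have key : ∀ P Q, frobInner G (P * Bᵀ + A * Qᵀ) +
      lam * (frobInner A P + frobInner B Q) = 0 := by
    intro P Q
    have h1 := fderiv_regLora_apply (lam := lam) hL (A, B) (P, Q)
    rw [h] at h1
    rw [hG, frobInner_grad]
    exact h1.symm
  have zero_of : ∀ {l : ℕ} (M : Matrix (Fin l) (Fin r) ℝ), frobInner M M = 0 → M = 0 := by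
    intro l M hM
    rw [← norm_sq_eq_frobInner] at hM
    exact norm_eq_zero.1 (pow_eq_zero_iff two_ne_zero |>.1 hM)
  constructor
  -- Testing on the residual itself makes its squared norm vanish.
  · have h1 := key (G * B + lam • A) 0
    have h2 : G * B + lam • A = 0 := by
      refine zero_of _ ?_
      rw [frobInner_add_left, frobInner_smul_left, ← h1]
      simp only [transpose_zero, Matrix.mul_zero, add_zero, frobInner_mul_transpose]
      simp [frobInner]
    rw [Matrix.neg_mul, neg_eq_iff_add_eq_zero, h2]
  · have h1 := key 0 (Gᵀ * A + lam • B)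
    have h2 : Gᵀ * A + lam • B = 0 := by
      refine zero_of _ ?_
      rw [frobInner_add_left, frobInner_smul_left, ← h1]
      simp only [Matrix.zero_mul, zero_add, frobInner_mul_transpose']
      simp [frobInner]
    rw [transpose_neg, Matrix.neg_mul, neg_eq_iff_add_eq_zero, h2]

end Lora

/-- First-order optimality of a minimizer of the nuclear-norm regularized loss. -/
theorem frobInner_grad_add_nuclearNorm_nonneg {L : Matrix (Fin m) (Fin n) ℝ → ℝ} {lam : ℝ}
    (hL : Differentiable ℝ L) (hlam : 0 ≤ lam) {Xs : Matrix (Fin m) (Fin n) ℝ}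
    (hmin : IsGlobalMin (regFull lam L) Xs) (X : Matrix (Fin m) (Fin n) ℝ) :
    0 ≤ frobInner (grad L Xs) (X - Xs) + lam * (nuclearNorm X - nuclearNorm Xs) := by
  rw [frobInner_grad]
  set c := lam * (nuclearNorm X - nuclearNorm Xs) with hc
  have h1 := hasDerivAt_add_line (hL Xs) (X - Xs) c
  -- Convexity replaces the nuclear norm along the segment by its chord, so only a differentiable
  -- function needs a one-sided slope.
  have h2 := (hasDerivWithinAt_iff_tendsto_slope' (Set.notMem_Ioi.2 le_rfl)).1
    (h1.hasDerivWithinAt (s := Set.Ioi 0))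
  refine ge_of_tendsto h2 ?_
  filter_upwards [Ioo_mem_nhdsGT (zero_lt_one (α := ℝ))] with t ht
  rw [slope_def_field]
  refine div_nonneg ?_ (by linarith [ht.1])
  have h3 := hmin (Xs + t • (X - Xs))
  have h4 := mul_le_mul_of_nonneg_left (nuclearNorm_convex X Xs ht.1.le ht.2.le) hlam
  simp only [regFull] at h3
  simp only [zero_smul, add_zero, zero_mul]
  rw [hc]
  linarith

end Calculus

/-! ### Consequences of stationarity: alignment, full rank and curvature. -/

section FullRank

variable {m n r : ℕ}

/-- Either the operator norm of `T` is at most `c`, or `T` has a leading pair of singular vectors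
with singular value larger than `c`. -/
theorem le_or_exists_singular_pair (T : Matrix (Fin m) (Fin n) ℝ) {c : ℝ} (hc : 0 ≤ c) :
    (∀ x, T *ᵥ x ⬝ᵥ T *ᵥ x ≤ c ^ 2 * (x ⬝ᵥ x)) ∨
      ∃ γ z w, c < γ ∧ z ⬝ᵥ z = 1 ∧ w ⬝ᵥ w = 1 ∧ T *ᵥ w = γ • z ∧ Tᵀ *ᵥ z = γ • w ∧
        ∀ x, T *ᵥ x ⬝ᵥ T *ᵥ x ≤ γ ^ 2 * (x ⬝ᵥ x) := by
  obtain ⟨v, u, h⟩ := exists_isSVD T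
  have key : ∀ g : ℝ, (∀ i : Fin n, (toEuclideanLin T).singularValues i ≤ g) →
      ∀ x, T *ᵥ x ⬝ᵥ T *ᵥ x ≤ g ^ 2 * (x ⬝ᵥ x) := by
    intro g hg x
    rw [h.mulVec_dotProduct_self, h.dotProduct_self_eq_sum, Finset.mul_sum]
    exact Finset.sum_le_sum fun i _ => mul_le_mul_of_nonneg_right
      (pow_le_pow_left₀ (h.nonneg i) (hg i) 2) (sq_nonneg _)
  by_cases hle : ∀ i : Fin n, (toEuclideanLin T).singularValues i ≤ c
  · exact Or.inl (key c hle)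
  · push Not at hle
    obtain ⟨i, hi⟩ := hle
    have hanti : ∀ j : Fin n, (toEuclideanLin T).singularValues j ≤
        (toEuclideanLin T).singularValues 0 := fun j =>
      (toEuclideanLin T).singularValues_antitone (Nat.zero_le _)
    let i₀ : Fin n := ⟨0, i.pos⟩
    have hlt := hi.trans_le (hanti i)
    exact Or.inr ⟨_, u i₀, v i₀, hlt, h.unit i₀ (hc.trans_lt hlt), by simp [h.orthonormal],
      h.mulVec i₀, h.transpose_mulVec i₀, key _ hanti⟩

/-- `z` and `x` satisfy the eigenvector equations of `T Tᵀ` for the distinct values `γ²` and `lam²`.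
-/
theorem dotProduct_eq_zero_of_singular_pairs {T : Matrix (Fin m) (Fin n) ℝ} {lam γ : ℝ}
    (hlam : 0 ≤ lam) (hγ : lam < γ) {x z : Fin m → ℝ} {y w : Fin n → ℝ} (hw : T *ᵥ w = γ • z)
    (hz : Tᵀ *ᵥ z = γ • w) (hy : T *ᵥ y = lam • x) (hx : Tᵀ *ᵥ x = lam • y) : z ⬝ᵥ x = 0 := by
  have h1 : γ * (z ⬝ᵥ x) = lam * (w ⬝ᵥ y) := by
    have := dotProduct_mulVec_transpose T x w
    rw [hw, hx, dotProduct_smul, smul_dotProduct, smul_eq_mul, smul_eq_mul, dotProduct_comm x,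
      dotProduct_comm y] at this
    exact this
  have h2 : γ * (w ⬝ᵥ y) = lam * (z ⬝ᵥ x) := by
    have := dotProduct_mulVec_transpose T z y
    rw [hy, hz, dotProduct_smul, smul_dotProduct, smul_eq_mul, smul_eq_mul] at this
    exact this.symm
  have h3 : (γ ^ 2 - lam ^ 2) * (z ⬝ᵥ x) = 0 := by linear_combination γ * h1 + lam * h2
  refine (mul_eq_zero.1 h3).resolve_left ?_
  nlinarith

theorem transpose_mul_self_eq {T : Matrix (Fin m) (Fin n) ℝ} {A : Matrix (Fin m) (Fin r) ℝ}
    {B : Matrix (Fin n) (Fin r) ℝ} {lam : ℝ} (hTB : T * B = lam • A) (hTA : Tᵀ * A = lam • B)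
    (hl : lam ≠ 0) : Aᵀ * A = Bᵀ * B := by
  refine smul_right_injective _ hl ?_
  change lam • (Aᵀ * A) = lam • (Bᵀ * B)
  rw [← Matrix.mul_smul, ← hTB, ← Matrix.smul_mul, ← transpose_smul, ← hTA, transpose_mul,
    transpose_transpose, Matrix.mul_assoc]

/-- At a first-order stationary point the factors are balanced along the singular vectors. -/
theorem balanced_singular_vectors {T X : Matrix (Fin m) (Fin n) ℝ} {A : Matrix (Fin m) (Fin r) ℝ}
    {B : Matrix (Fin n) (Fin r) ℝ} {lam s : ℝ} (hTB : T * B = lam • A) (hTA : Tᵀ * A = lam • B)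
    (hX : X = A * Bᵀ) (hs : 0 < s) {x : Fin m → ℝ} {y : Fin n → ℝ} (hXy : X *ᵥ y = s • x)
    (hXx : Xᵀ *ᵥ x = s • y) : lam • (Aᵀ *ᵥ x) = lam • (Bᵀ *ᵥ y) := by
  rcases eq_or_ne lam 0 with rfl | hl
  · simp
  have hbal := transpose_mul_self_eq hTB hTA hl
  have hAq : A *ᵥ (Bᵀ *ᵥ y) = s • x := by rw [mulVec_mulVec, ← hX, hXy]
  have hBp : B *ᵥ (Aᵀ *ᵥ x) = s • y := by
    rw [mulVec_mulVec, ← hXx, hX, transpose_mul, transpose_transpose]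
  set d := Aᵀ *ᵥ x - Bᵀ *ᵥ y with hd
  -- `Aᵀ A` is positive semidefinite and `-s < 0`, so `d` must vanish.
  have h1 : Aᵀ *ᵥ (A *ᵥ d) = -(s • d) := by
    rw [hd, mulVec_sub, mulVec_sub, hAq, mulVec_mulVec, hbal, ← mulVec_mulVec, hBp, mulVec_smul,
      mulVec_smul, ← smul_sub, ← smul_neg, neg_sub]
  have h2 : A *ᵥ d ⬝ᵥ A *ᵥ d = -(s * (d ⬝ᵥ d)) := by
    rw [dotProduct_mulVec_transpose, h1, neg_dotProduct, smul_dotProduct, smul_eq_mul]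
  have h3 : d ⬝ᵥ d = 0 := by
    have h4 := dotProduct_self_nonneg' (A *ᵥ d)
    have h5 := dotProduct_self_nonneg' d
    nlinarith
  rw [sub_eq_zero.1 (dotProduct_self_eq_zero.1 h3)]

/-- `s T y = T B Aᵀ x = lam A Aᵀ x = lam A Bᵀ y = lam s x`, and symmetrically. Balance is only
needed multiplied by `lam`, which covers `lam = 0`. -/
theorem mulVec_singular_vectors {T X : Matrix (Fin m) (Fin n) ℝ} {A : Matrix (Fin m) (Fin r) ℝ}
    {B : Matrix (Fin n) (Fin r) ℝ} {lam s : ℝ} (hTB : T * B = lam • A) (hTA : Tᵀ * A = lam • B)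
    (hX : X = A * Bᵀ) (hs : 0 < s) {x : Fin m → ℝ} {y : Fin n → ℝ} (hXy : X *ᵥ y = s • x)
    (hXx : Xᵀ *ᵥ x = s • y) : T *ᵥ y = lam • x ∧ Tᵀ *ᵥ x = lam • y := by
  have hpq := balanced_singular_vectors hTB hTA hX hs hXy hXx
  have hAq : A *ᵥ (Bᵀ *ᵥ y) = s • x := by rw [mulVec_mulVec, ← hX, hXy]
  have hBp : B *ᵥ (Aᵀ *ᵥ x) = s • y := by
    rw [mulVec_mulVec, ← hXx, hX, transpose_mul, transpose_transpose]
  constructor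
  · refine smul_right_injective _ hs.ne' ?_
    change s • T *ᵥ y = s • lam • x
    rw [← mulVec_smul, ← hBp, mulVec_mulVec, hTB, smul_mulVec, ← mulVec_smul, hpq, mulVec_smul,
      hAq, smul_comm]
  · refine smul_right_injective _ hs.ne' ?_
    change s • Tᵀ *ᵥ x = s • lam • y
    rw [← mulVec_smul, ← hAq, mulVec_mulVec, hTA, smul_mulVec, ← mulVec_smul, ← hpq, mulVec_smul,
      hBp, smul_comm]

theorem hessQuad_smul {E : Type*} [NormedAddCommGroup E] [NormedSpace ℝ E] (f : E → ℝ) (x u : E)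
    (t : ℝ) : hessQuad f x (t • u) = t ^ 2 * hessQuad f x u := by
  simp only [hessQuad, map_smul, _root_.smul_apply, smul_eq_mul]
  ring

section Stationary

variable {L : Matrix (Fin m) (Fin n) ℝ → ℝ} {lam : ℝ} {A : Matrix (Fin m) (Fin r) ℝ}
  {B : Matrix (Fin n) (Fin r) ℝ}

/-- The second-order condition along directions `(z pᵀ, w qᵀ)`. -/
theorem hess_rank_one_nonneg (hL : TwiceDifferentiable L)
    (hsosp : IsSOSP (regLora r lam L) (A, B)) (z : Fin m → ℝ) (w : Fin n → ℝ) (p q : Fin r → ℝ) :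
    0 ≤ hessQuad L (A * Bᵀ) (vecMulVec z (B *ᵥ p) + vecMulVec (A *ᵥ q) w) -
      2 * ((p ⬝ᵥ q) * (z ⬝ᵥ (-grad L (A * Bᵀ)) *ᵥ w)) +
        lam * ((z ⬝ᵥ z) * (p ⬝ᵥ p) + (w ⬝ᵥ w) * (q ⬝ᵥ q)) := by
  have h := hsosp.2 (vecMulVec z p, vecMulVec w q)
  rw [hessQuad_regLora hL, norm_vecMulVec_sq, norm_vecMulVec_sq, ← frobInner_grad,
    transpose_vecMulVec, vecMulVec_mul_vecMulVec, vecMulVec_mul, mul_vecMulVec,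
    vecMul_transpose, vecMulVec_smul, frobInner_smul_right, frobInner_vecMulVec] at h
  rw [neg_mulVec, dotProduct_neg]
  linarith

/-- For `lam = 0` the negative linear term wins at small `t`; for `h = 0` take `t = 1`. -/
theorem not_nonneg_of_small_quadratic {h N lam γ : ℝ} (hN : 0 < N) (hlam : 0 ≤ lam) (hγ : lam < γ)
    (h0 : lam = 0 ∨ h = 0) :
    ¬ ∀ t : ℝ, 0 ≤ t ^ 2 * h - 2 * (t * N * γ) + lam * (t ^ 2 * N + N) := by
  intro H
  rcases h0 with rfl | rfl
  · have hpos : 0 < |h| + 1 := by positivity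
    have h1 := H (γ * N / (|h| + 1))
    have ht : 0 < γ * N / (|h| + 1) := by positivity
    have h2 : γ * N / (|h| + 1) * (|h| + 1) = γ * N := div_mul_cancel₀ _ hpos.ne'
    set t := γ * N / (|h| + 1)
    have h3 : t * h ≤ γ * N := by nlinarith [le_abs_self h]
    nlinarith [mul_pos ht (mul_pos hγ hN)]
  · have h1 := H 1
    nlinarith

/-- A kernel vector `q` of one factor leaves a Hessian term in only one block. Scaling that block by
`t` gives the quadratic above; if `lam ≠ 0`, balance puts `q` in both kernels and the term
disappears. -/
theorem injective_of_isSOSP (hL : TwiceDifferentiable L) (hlam : 0 ≤ lam)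
    (hsosp : IsSOSP (regLora r lam L) (A, B)) {γ : ℝ} {z : Fin m → ℝ} {w : Fin n → ℝ}
    (hγ : lam < γ) (hz : z ⬝ᵥ z = 1) (hw : w ⬝ᵥ w = 1)
    (hTw : (-grad L (A * Bᵀ)) *ᵥ w = γ • z) :
    (∀ q, A *ᵥ q = 0 → q = 0) ∧ ∀ q, B *ᵥ q = 0 → q = 0 := by
  obtain ⟨hTB, hTA⟩ := grad_mul_of_fderiv_regLora_eq_zero hL.1 hsosp.1
  have hbal : lam = 0 ∨ Aᵀ * A = Bᵀ * B :=
    (eq_or_ne lam 0).imp_right (transpose_mul_self_eq hTB hTA)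
  have hker : ∀ q, lam = 0 ∨ A *ᵥ q ⬝ᵥ A *ᵥ q = B *ᵥ q ⬝ᵥ B *ᵥ q := fun q => by
    refine hbal.imp_right fun h => ?_
    rw [dotProduct_mulVec_transpose, mulVec_mulVec, h, ← mulVec_mulVec,
      ← dotProduct_mulVec_transpose]
  have hzT : z ⬝ᵥ (-grad L (A * Bᵀ)) *ᵥ w = γ := by
    rw [hTw, dotProduct_smul, hz, smul_eq_mul, mul_one]
  have hpos : ∀ q : Fin r → ℝ, q ≠ 0 → 0 < q ⬝ᵥ q := fun q hq =>
    (dotProduct_self_nonneg' q).lt_of_ne' fun h => hq (dotProduct_self_eq_zero.1 h)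
  have hz0 : vecMulVec z (0 : Fin n → ℝ) = 0 := by
    ext i j
    simp [vecMulVec_apply]
  constructor
  · intro q hq
    by_contra hne
    refine not_nonneg_of_small_quadratic (h := hessQuad L (A * Bᵀ) (vecMulVec z (B *ᵥ q)))
      (hpos q hne) hlam hγ ((hker q).imp_right fun h => ?_) fun t => ?_
    · rw [hq, dotProduct_zero, eq_comm, dotProduct_self_eq_zero] at h
      simp [h, hz0, hessQuad]
    · have h1 := hess_rank_one_nonneg hL hsosp z w (t • q) q
      rw [hq, zero_vecMulVec, add_zero, mulVec_smul, vecMulVec_smul, hessQuad_smul, hzT, hz, hw]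
        at h1
      simp only [smul_dotProduct, dotProduct_smul, smul_eq_mul] at h1
      linarith
  · intro q hq
    by_contra hne
    refine not_nonneg_of_small_quadratic (h := hessQuad L (A * Bᵀ) (vecMulVec (A *ᵥ q) w))
      (hpos q hne) hlam hγ ((hker q).imp_right fun h => ?_) fun t => ?_
    · rw [hq, dotProduct_zero, dotProduct_self_eq_zero] at h
      simp [h, hessQuad]
    · have h1 := hess_rank_one_nonneg hL hsosp z w q (t • q)
      rw [hq, hz0, zero_add, mulVec_smul, smul_vecMulVec, hessQuad_smul, hzT, hz, hw]
        at h1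
      simp only [smul_dotProduct, dotProduct_smul, smul_eq_mul] at h1
      linarith

/-- The gap between a stationary point and a regularized minimizer is controlled by the excess of
the dual variable `-∇L(X)` over the nuclear norm at the minimizer. -/
theorem frobInner_grad_sub_le (hL : TwiceDifferentiable L) (hlam : 0 ≤ lam)
    {Xs : Matrix (Fin m) (Fin n) ℝ} (hmin : IsGlobalMin (regFull lam L) Xs)
    (hsosp : IsSOSP (regLora r lam L) (A, B)) :
    frobInner (grad L (A * Bᵀ) - grad L Xs) (A * Bᵀ - Xs) ≤
      frobInner (-grad L (A * Bᵀ)) Xs - lam * nuclearNorm Xs := by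
  obtain ⟨hTB, hTA⟩ := grad_mul_of_fderiv_regLora_eq_zero hL.1 hsosp.1
  have h1 := frobInner_grad_add_nuclearNorm_nonneg hL.1 hlam hmin (A * Bᵀ)
  have h2 := mul_le_mul_of_nonneg_left (nuclearNorm_mul_transpose_le A B) hlam
  have h3 := frobInner_mul_transpose (-grad L (A * Bᵀ)) A B
  have h4 := frobInner_mul_transpose' (-grad L (A * Bᵀ)) A B
  rw [hTB, frobInner_smul_left, ← norm_sq_eq_frobInner, frobInner_neg_left] at h3
  rw [hTA, frobInner_smul_left, ← norm_sq_eq_frobInner, frobInner_neg_left] at h4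
  rw [frobInner_sub_left, frobInner_neg_left, frobInner_sub_right (grad L (A * Bᵀ))]
  linarith

theorem pos_of_frobInner_grad {Xs X : Matrix (Fin m) (Fin n) ℝ} {a : ℝ} (ha : 0 < a)
    (hne : X ≠ Xs) (hrsc : a * ‖X - Xs‖ ^ 2 ≤ frobInner (grad L X - grad L Xs) (X - Xs)) :
    0 < frobInner (grad L X - grad L Xs) (X - Xs) := by
  have : 0 < ‖X - Xs‖ := norm_pos_iff.2 (sub_ne_zero.2 hne)
  exact lt_of_lt_of_le (by positivity) hrsc

theorem eq_zero_of_rank_eq_zero {X : Matrix (Fin m) (Fin n) ℝ} (h : X.rank = 0) : X = 0 := by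
  obtain ⟨v, u, hX⟩ := exists_isSVD X
  have h1 := hX.norm_sq
  rw [Finset.sum_eq_zero fun i _ => by
    rw [(singularValues_eq_zero_iff_rank_le X i).2 (h ▸ Nat.zero_le _), sq, mul_zero]] at h1
  exact norm_eq_zero.1 (pow_eq_zero_iff two_ne_zero |>.1 h1)

/-- A second-order stationary point other than the regularized minimizer `Xs` has full rank `r`,
and there is a direction `U X + X V` such that any bound `b` on the curvature along it controls the
distance of `X` to `Xs` from below. -/
theorem exists_direction_of_ne (hL : TwiceDifferentiable L) (hlam : 0 ≤ lam)
    {Xs X : Matrix (Fin m) (Fin n) ℝ} (hmin : IsGlobalMin (regFull lam L) Xs)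
    (hsosp : IsSOSP (regLora r lam L) (A, B)) (hX : X = A * Bᵀ) {rs : ℕ} (hrank : Xs.rank = rs)
    (hr : rs ≤ r) (hne : X ≠ Xs) {a : ℝ} (ha : 0 < a)
    (hrsc : a * ‖X - Xs‖ ^ 2 ≤ frobInner (grad L X - grad L Xs) (X - Xs)) :
    1 ≤ rs ∧ X.rank = r ∧ ∃ (U : Matrix (Fin m) (Fin m) ℝ) (V : Matrix (Fin n) (Fin n) ℝ),
      U.rank = 1 ∧ ‖U‖ = 1 ∧ V.rank = 1 ∧ ‖V‖ = 1 ∧ 0 < ‖U * X + X * V‖ ^ 2 ∧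
      ∀ b, hessQuad L X (U * X + X * V) ≤ b * ‖U * X + X * V‖ ^ 2 →
        0 < b ∧ ∃ Y : Matrix (Fin m) (Fin n) ℝ, Y.rank ≤ rs ∧
          b * singVal X r * ‖X - Y‖ ^ 2 ≤
            (b * singVal X r - 2 * a * singVal X rs) * ‖X - Xs‖ ^ 2 := by
  obtain ⟨hTB, hTA⟩ := grad_mul_of_fderiv_regLora_eq_zero hL.1 hsosp.1
  have hgap := frobInner_grad_sub_le hL hlam hmin hsosp
  have hpos := pos_of_frobInner_grad ha hne hrsc
  rw [← hX] at hgap hTB hTA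
  rcases le_or_exists_singular_pair (-grad L X) hlam with hT | ⟨γ, z, w, hγ, hz, hw, hTw, hTz, hT⟩
  -- If `T` had operator norm at most `lam`, duality would contradict the positive gap.
  · linarith [frobInner_le_nuclearNorm (X := Xs) hlam hT]
  have hγ0 : 0 < γ := hlam.trans_lt hγ
  obtain ⟨hA, hB⟩ := injective_of_isSOSP hL hlam hsosp hγ hz hw (hX ▸ hTw)
  have hrk : X.rank = r := hX ▸ rank_mul_transpose_of_injective hA hB
  obtain ⟨v, u, hS⟩ := exists_isSVD X
  have hsing : ∀ j : Fin n, 0 < (toEuclideanLin X).singularValues j →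
      (-grad L X) *ᵥ v j = lam • u j ∧ (-grad L X)ᵀ *ᵥ u j = lam • v j := fun j hj =>
    mulVec_singular_vectors hTB hTA hX hj (hS.mulVec j) (hS.transpose_mulVec j)
  obtain ⟨W, hWu, hW, hTW⟩ := hS.exists_complement_part hγ0 (fun j hj => (hsing j hj).1)
    (fun j hj => (hsing j hj).2) hT
  have hXsW := hS.frobInner_le_nuclearNorm_add hlam hWu hW hTW Xs
  have hWpos : 0 < (γ - lam) * frobInner W Xs := by linarith
  have hWpos' : 0 < frobInner W Xs := pos_of_mul_pos_right hWpos (by linarith)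
  have hrs : 1 ≤ rs := by
    rw [Nat.one_le_iff_ne_zero]
    rintro rfl
    rw [eq_zero_of_rank_eq_zero hrank] at hWpos'
    simp [frobInner] at hWpos'
  have hrn : r ≤ n := hrk ▸ X.rank_le_width
  let i : Fin n := ⟨r - 1, by omega⟩
  have hσ : 0 < singVal X r := (singularValues_pos_iff X (r - 1)).2 (by omega)
  have hXv : X *ᵥ v i = singVal X r • u i := hS.mulVec i
  have hXu : Xᵀ *ᵥ u i = singVal X r • v i := hS.transpose_mulVec i
  have hui : u i ⬝ᵥ u i = 1 := hS.unit i hσ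
  have hvi : v i ⬝ᵥ v i = 1 := by simp [hS.orthonormal]
  have hUX : vecMulVec z (u i) * X = singVal X r • vecMulVec z (v i) := by
    rw [vecMulVec_mul, ← mulVec_transpose, hXu, vecMulVec_smul]
  have hXV : X * vecMulVec (v i) w = singVal X r • vecMulVec (u i) w := by
    rw [mul_vecMulVec, hXv, smul_vecMulVec]
  have hnorm : ‖vecMulVec z (u i) * X + X * vecMulVec (v i) w‖ ^ 2 = 2 * singVal X r ^ 2 := by
    have hzu := dotProduct_eq_zero_of_singular_pairs hlam hγ hTw hTz (hsing i hσ).1 (hsing i hσ).2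
    rw [hUX, hXV, norm_sq_eq_frobInner, ← smul_add, frobInner_smul_left, frobInner_smul_right]
    simp only [frobInner_add_left, frobInner_add_right, frobInner_vecMulVec_vecMulVec, hz, hw, hui,
      hvi, hzu, dotProduct_comm (u i) z]
    ring
  refine ⟨hrs, hrk, vecMulVec z (u i), vecMulVec (v i) w, rank_vecMulVec_eq_one hz hui,
    norm_vecMulVec_eq_one hz hui, rank_vecMulVec_eq_one hvi hw, norm_vecMulVec_eq_one hvi hw,
    by rw [hnorm]; positivity, fun b hb => ?_⟩
  have hcurv : γ - lam ≤ b * singVal X r := by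
    -- With this choice `B p = Xᵀ u` and `A q = X v`, so the direction has the form `U X + X V`; the
    -- cross term pairs to `σ_r γ`.
    have h1 := hess_rank_one_nonneg hL hsosp z w (Aᵀ *ᵥ u i) (Bᵀ *ᵥ v i)
    have hpq : Aᵀ *ᵥ u i ⬝ᵥ Bᵀ *ᵥ v i = singVal X r := by
      rw [← dotProduct_mulVec_transpose, mulVec_mulVec, ← hX, hXv, dotProduct_smul, hui,
        smul_eq_mul, mul_one]
    have hbal := balanced_singular_vectors hTB hTA hX hσ hXv hXu
    have hpp : lam * (Aᵀ *ᵥ u i ⬝ᵥ Aᵀ *ᵥ u i) = lam * singVal X r := by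
      rw [← smul_eq_mul lam (_ ⬝ᵥ _), ← dotProduct_smul, hbal, dotProduct_smul, hpq, smul_eq_mul]
    have hqq : lam * (Bᵀ *ᵥ v i ⬝ᵥ Bᵀ *ᵥ v i) = lam * singVal X r := by
      rw [← smul_eq_mul lam (_ ⬝ᵥ _), ← smul_dotProduct, ← hbal, smul_dotProduct, hpq, smul_eq_mul]
    have hBA : B *ᵥ Aᵀ *ᵥ u i = u i ᵥ* X := by
      rw [mulVec_mulVec, ← mulVec_transpose, hX, transpose_mul, transpose_transpose]
    rw [hpq, hz, hw, hBA, mulVec_mulVec, ← hX, hTw, dotProduct_smul, hz, ← vecMulVec_mul,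
      ← mul_vecMulVec, smul_eq_mul] at h1
    rw [hnorm] at hb
    have h2 : 0 ≤ 2 * singVal X r * (b * singVal X r - (γ - lam)) := by linarith
    have h3 := nonneg_of_mul_nonneg_right h2 (by positivity)
    linarith
  have hb0 : 0 < b := pos_of_mul_pos_left (by linarith) hσ.le
  -- The leading `rs` indices; `singVal X rs` sits at index `rs - 1`, so it separates `J` from its
  -- complement.
  let J : Finset (Fin n) := Finset.univ.filter fun j => (j : ℕ) < rs
  have hJ : ∀ j : Fin n, j ∈ J ↔ (j : ℕ) < rs := by simp [J]
  have hJcard : J.card ≤ rs := by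
    calc J.card = (J.map Fin.valEmbedding).card := (Finset.card_map _).symm
      _ ≤ (Finset.range rs).card := Finset.card_le_card fun k hk => by
          obtain ⟨j, hj, rfl⟩ := Finset.mem_map.1 hk
          exact Finset.mem_range.2 ((hJ j).1 hj)
      _ = rs := Finset.card_range rs
  obtain ⟨Y, hYrank, hYdist⟩ := hS.exists_rank_le J
  obtain ⟨q, p, hSs⟩ := exists_isSVD Xs
  have hs : 0 ≤ singVal X rs := (toEuclideanLin X).singularValues_nonneg _
  have hdist := hS.two_mul_frobInner_le hWu hW J (s := singVal X rs) hs
    (fun j hj => (toEuclideanLin X).singularValues_antitone (by have := (hJ j).1 hj; omega))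
    (fun j hj => (toEuclideanLin X).singularValues_antitone (by
      have := mt (hJ j).2 hj; omega)) hSs
    (fun j hj => (singularValues_eq_zero_iff_rank_le Xs j).2 (by
      have := mt (hJ j).2 hj; omega))
  rw [← hYdist] at hdist
  refine ⟨hb0, Y, hYrank.trans hJcard, ?_⟩
  have h1 : a * ‖X - Xs‖ ^ 2 ≤ b * singVal X r * frobInner W Xs :=
    calc a * ‖X - Xs‖ ^ 2 ≤ (γ - lam) * frobInner W Xs := by linarith
      _ ≤ _ := mul_le_mul_of_nonneg_right hcurv hWpos'.le
  have h2 := mul_le_mul_of_nonneg_left h1 hs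
  have h3 := mul_le_mul_of_nonneg_left hdist (mul_nonneg hb0.le hσ.le)
  linarith

end Stationary

end FullRank

end LoRA

/-! ### The theorem for the extended-real RSC and RSM constants. -/

theorem theorem1 {m n K N : ℕ} {𝒳 𝒴 : Type*}
    (ℓ : (Fin K → ℝ) → 𝒴 → ℝ) (net : Matrix (Fin m) (Fin n) ℝ → 𝒳 → Fin K → ℝ)
    (W₀ : Matrix (Fin m) (Fin n) ℝ) (x : Fin N → 𝒳) (y : Fin N → 𝒴)
    (L : Matrix (Fin m) (Fin n) ℝ → ℝ) (hL : L = LoRA.fullLoss ℓ net W₀ x y)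
    (hdiff : LoRA.TwiceDifferentiable L)
    (lam : ℝ) (hlam : 0 ≤ lam)
    (r rs : ℕ) (hr : rs ≤ r) (D : ℝ)
    (Xs : Matrix (Fin m) (Fin n) ℝ) (hrank : Xs.rank = rs)
    (hmin : LoRA.IsGlobalMin (LoRA.regFull lam L) Xs)
    (α β : EReal) (hα : α = LoRA.rscConst L Xs r D) (hβ : β = LoRA.rsmConst L Xs r D)
    (hαpos : 0 < α) (hβfin : β < ⊤)
    (A : Matrix (Fin m) (Fin r) ℝ) (B : Matrix (Fin n) (Fin r) ℝ)
    (hsosp : LoRA.IsSOSP (LoRA.regLora r lam L) (A, B))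
    (X : Matrix (Fin m) (Fin n) ℝ) (hX : X = A * B.transpose) (hD : ‖X - Xs‖ ≤ D) :
    (β < 2 * α → LoRA.IsGlobalMin (LoRA.regFull lam L) X) ∧
    (2 * α ≤ β →
      LoRA.IsGlobalMin (LoRA.regFull lam L) X ∨
      (¬ LoRA.IsGlobalMin (LoRA.regFull lam L) X ∧
        1 ≤ rs ∧ X.rank = r ∧
        2 * α.toReal / β.toReal * LoRA.singVal X rs ≤ LoRA.singVal X r ∧
        ∀ P : Matrix (Fin m) (Fin n) ℝ, LoRA.IsRankProj rs X P →
          ‖X - P‖ ^ 2 /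
              (1 - 2 * α.toReal * LoRA.singVal X rs / (β.toReal * LoRA.singVal X r))
            ≤ ‖X - Xs‖ ^ 2 ∧
          (2 * α.toReal / β.toReal * LoRA.singVal X rs = LoRA.singVal X r → P = X))) := by
  by_cases hne : X = Xs
  · exact ⟨fun _ => hne ▸ hmin, fun _ => Or.inl (hne ▸ hmin)⟩
  have hd : 0 < ‖X - Xs‖ ^ 2 := pow_pos (norm_pos_iff.2 (sub_ne_zero.2 hne)) 2
  have hXr : X.rank ≤ r := hX ▸ (Matrix.rank_mul_le_left _ _).trans A.rank_le_width
  -- Since `X ≠ Xs`, the quotient at `X` bounds every admissible constant. This makes `α` finite and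
  -- gives the RSC inequality at `X`; `hβge` does the same for `β` with the direction found.
  have hαle : α ≤ ((LoRA.frobInner (LoRA.grad L X - LoRA.grad L Xs) (X - Xs) /
      ‖X - Xs‖ ^ 2 : ℝ) : EReal) := by
    rw [hα]
    refine sSup_le ?_
    rintro _ ⟨a, ha, rfl⟩
    exact EReal.coe_le_coe_iff.2 ((le_div_iff₀ hd).2 (ha X hD hXr))
  lift α to ℝ using ⟨(hαle.trans_lt (EReal.coe_lt_top _)).ne, (EReal.bot_lt_zero.trans hαpos).ne'⟩
  have ha : 0 < α := EReal.coe_pos.1 hαpos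
  have hrsc := (le_div_iff₀ hd).1 (EReal.coe_le_coe_iff.1 hαle)
  obtain ⟨hrs, hrk, U, V, hU, hU1, hV, hV1, hdir, hbound⟩ :=
    LoRA.exists_direction_of_ne hdiff hlam hmin hsosp hX hrank hr hne ha hrsc
  have hβge : ((LoRA.hessQuad L X (U * X + X * V) / ‖U * X + X * V‖ ^ 2 : ℝ) : EReal) ≤ β := by
    rw [hβ]
    refine le_sInf ?_
    rintro _ ⟨b, hb, rfl⟩
    exact EReal.coe_le_coe_iff.2 ((div_le_iff₀ hdir).2 (hb X hD hXr U hU hU1 V hV hV1))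
  lift β to ℝ using ⟨hβfin.ne, ((EReal.bot_lt_coe _).trans_le hβge).ne'⟩
  obtain ⟨hb, Y, hYrank, hY⟩ := hbound β ((div_le_iff₀ hdir).1 (EReal.coe_le_coe_iff.1 hβge))
  have hσ : 0 < LoRA.singVal X r := (LoRA.singularValues_pos_iff X (r - 1)).2 (by omega)
  have hσle : LoRA.singVal X r ≤ LoRA.singVal X rs :=
    (Matrix.toEuclideanLin X).singularValues_antitone (by omega)
  have hbσ : 0 < β * LoRA.singVal X r := mul_pos hb hσ
  have hY0 : 0 ≤ β * LoRA.singVal X r * ‖X - Y‖ ^ 2 := by positivity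
  have hgap : 0 ≤ β * LoRA.singVal X r - 2 * α * LoRA.singVal X rs :=
    nonneg_of_mul_nonneg_left (hY0.trans hY) hd
  refine ⟨fun hlt => ?_, fun _ => ?_⟩
  -- `β < 2 α` and `σ_r ≤ σ_rs` contradict `2 α σ_rs ≤ β σ_r`, so `X ≠ Xs` is impossible here.
  · exfalso
    have h2 : ((2 : ℝ) : EReal) * (α : EReal) = ((2 * α : ℝ) : EReal) := (EReal.coe_mul _ _).symm
    have h1 : β < 2 * α := EReal.coe_lt_coe_iff.1 (hlt.trans_eq h2)
    nlinarith
  by_cases hglob : LoRA.IsGlobalMin (LoRA.regFull lam L) X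
  · exact Or.inl hglob
  simp only [EReal.toReal_coe]
  refine Or.inr ⟨hglob, hrs, hrk, ?_, fun P hP => ?_⟩
  · rw [div_mul_eq_mul_div, div_le_iff₀ hb]
    linarith
  have hPY : ‖X - P‖ ^ 2 ≤ ‖X - Y‖ ^ 2 := pow_le_pow_left₀ (norm_nonneg _) (hP.2 Y hYrank) 2
  have hPd : β * LoRA.singVal X r * ‖X - P‖ ^ 2 ≤
      (β * LoRA.singVal X r - 2 * α * LoRA.singVal X rs) * ‖X - Xs‖ ^ 2 :=
    (mul_le_mul_of_nonneg_left hPY hbσ.le).trans hY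
  have hden : 1 - 2 * α * LoRA.singVal X rs / (β * LoRA.singVal X r) =
      (β * LoRA.singVal X r - 2 * α * LoRA.singVal X rs) / (β * LoRA.singVal X r) := by
    rw [sub_div, div_self hbσ.ne']
  constructor
  · rw [hden]
    rcases hgap.lt_or_eq with h0 | h0
    · rw [div_le_iff₀ (div_pos h0 hbσ), mul_div_assoc', le_div_iff₀ hbσ]
      linarith
    -- Zero denominator: division by zero returns `0`, the prescribed reading.
    · rw [← h0, zero_div, div_zero]
      exact hd.le
  · intro heq
    rw [div_mul_eq_mul_div, div_eq_iff hb.ne'] at heq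
    have h0 : β * LoRA.singVal X r * ‖X - P‖ ^ 2 ≤ 0 := by
      have h1 : β * LoRA.singVal X r - 2 * α * LoRA.singVal X rs = 0 := by linarith
      rwa [h1, zero_mul] at hPd
    have h1 : ‖X - P‖ ^ 2 ≤ 0 := nonpos_of_mul_nonpos_right h0 hbσ
    have h2 : ‖X - P‖ = 0 := pow_eq_zero_iff two_ne_zero |>.1 (le_antisymm h1 (sq_nonneg _))
    exact (sub_eq_zero.1 (norm_eq_zero.1 h2)).symm
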